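/- **Setting.** Let $d\ge 1$ and let $f$ be a continuous probability density on $\mathbb{R}^d$ with compact support $\mathcal X$; $X_1,\dots,X_n$ are i.i.d. with density $f$, and $X_{[n]}=\{X_1,\dots,X_n\}$. Write $d(x,M)=\inf_{y\in M}\|x-y\|$, $B(M,r)=\{x: d(x,M)\le r\}$, and $\mathcal X^t=\{x: f(x)\ge t\}$. A nonempty connected set $M\subset\mathcal X$ is a *modal-set* if $f$ equals a constant on $M$ and, for some $r>0$, $f$ is strictly smaller than this constant on $B(M,r)\setminus M$. Assume that $f$ has finitely many modal-sets, all in the interior of $\mathcal X$, and that every connected component of every $\mathcal X^t$, $t>0$, contains a modal-set. For $\epsilon_0\ge 0$, an *$\epsilon_0$-modal set* is a set $M$ with $f_M:=\sup_M f>\epsilon_0$ that is a connected component of $\mathcal X^{f_M-\epsilon_0}$; for $\epsilon_0=0$ these are exactly the modal-sets. Fix $\epsilon_0\ge0$ and assume that all $\epsilon_0$-modal sets lie in the interior of $\mathcal X$ and satisfy $f_M\ge 2\epsilon_0$, and that $f$ takes a value larger than $\epsilon_0$ on every connected component of $\{f>0\}$ (automatic if $\epsilon_0=0$). Fix $0<\delta<1$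 and $\tilde\epsilon\ge0$. **Algorithm.** Let $1\le k\le n$, $r_k(x)=\min\{r:|\{i: \|X_i-x\|\le r\}|\ge k\}$, $f_k(x)=\frac{k}{n v_d r_k(x)^d}$ with $v_d$ the volume of the unit ball, $C_{\delta,n}=16\log(2/\delta)\sqrt{d\log n}$, and $\beta_k=4C_{\delta,n}/\sqrt k$. Let $G(\lambda)$ be the graph on $\{x\in X_{[n]}: f_k(x)\ge\lambda\}$ with an edge between $x,x'$ iff $\|x-x'\|\le\min\{r_k(x),r_k(x')\}$. Start from $\widehat{\mathcal M}=\emptyset$ and process the sample points in decreasing order of $f_k$ (ties broken arbitrarily): at $X_i$, put $\lambda=f_k(X_i)$ and let $A$ be the connected component of $X_i$ in $G(\lambda-9\beta_k\lambda-\epsilon_0-\tilde\epsilon)$; if $A$ is disjoint from all members of $\widehat{\mathcal M}$, add to $\widehat{\mathcal M}$ the estimate $\{x\in A: f_k(x)>\lambda-\beta_k\lambda-\epsilon_0\}$, which is then said to be chosen at level $\lambda$. **Admissibility.** Consider, for an $\epsilon_0$-modal set $M$, a connected component $A_M\supseteq M$ of some $\mathcal X^{\lambda_M}$, numbers $r_M,r_s>0$,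 sets $S_M\subset\mathbb{R}^d$ and $M_0\subseteq M$, and strictly increasing continuous functions $l_M,u_M$ on $[0,r_M]$ vanishing at $0$, such that: $A_M$ meets no other $\epsilon_0$-modal set; every path from $A_M$ to $\mathcal X^{\lambda_M}\setminus A_M$ crosses $S_M$, and $\sup_{B(S_M,r_s)}f<\inf_{\mathcal X^{\lambda_M}}f$; $B(M,r_M)\subseteq A_M$; $l_M(d(x,M))\le f_M-\epsilon_0-f(x)\le u_M(d(x,M))$ on $B(M,r_M)\setminus M$; $M_0$ is a modal-set on which $f=f_M$, and $f_M-f(x)\le u_M(d(x,M_0))$ on $B(M_0,r_M)$. We say that $k$ is *admissible* for $M$ (with separation radius $r_s$) if such data exist with $\tilde\epsilon<l_M(\min\{r_M,r_s\}/2)$ and $$\max\left\{\left(\frac{24\,C_{\delta,n}(\sup f+\epsilon_0)}{l_M(\min\{r_M,r_s\}/2)-\tilde\epsilon}\right)^2,\;2^{7+d}C_{\delta,n}^2\right\}\le k\le\frac{v_d(f_M-\epsilon_0)}{2^{2+2d}}\left(u_M^{-1}\left(\frac{C_{\delta,n}(f_M-\epsilon_0)}{2\sqrt k}\right)\right)^d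 n ,$$ where the argument of $u_M^{-1}$ is required to lie in the range of $u_M$. **Theorem.** There is a function $\lambda_0=\lambda_0(n,k)$ with the following two properties. For $\lambda\in\mathbb{R}$ let $\mathcal M(\lambda)$ be the set of all $\epsilon_0$-modal sets $M$ with $$f_M\ge\min\{f(x): x\in X_{[n]},\ f_k(x)\ge\lambda-\beta_k\lambda\}$$ (the empty collection if no such $x$ exists). 1. For all $1\le k\le n$, with probability at least $1-\delta$, for every $t\ge\lambda_0(n,k)$: if $k$ is admissible for all $M\in\mathcal M(t)$, with a common separation radius, then the estimates chosen at levels $\lambda\ge t$ can be mapped injectively to $\epsilon_0$-modal sets in such a way that an estimate chosen at level $\lambda$ is mapped into $\mathcal M(\lambda)$. 2. Suppose $\tilde\epsilon=0$ and $f$ is Hölder continuous: $|f(x)-f(x')|\le c\|x-x'\|^\alpha$ for all $x,x'$, with some $0<\alpha\le1$, $c>0$. Then for all $C_1,C_2>0$ and every sequence $k=k(n)$ of natural numbers with $C_1\log n\le k\le C_2 n^{2\alpha/(2\alpha+d)}$ for all large $n$, $\lambda_0(n,k(n))\to0$ as $n\to\infty$. The case $\epsilon_0=\tilde\epsilon=0$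 is the statement about modal-sets. -/

import Mathlib

open Filter Topology MeasureTheory

noncomputable section

namespace MCores

/-- The ambient space `ℝ^d` with its Euclidean norm. -/
abbrev Pt (d : ℕ) : Type := EuclideanSpace ℝ (Fin d)

variable {d : ℕ}

/-! ### Modal-sets -/

/-- The level set `{x : f x ≥ t}`. -/
def levelSet (f : Pt d → ℝ) (t : ℝ) : Set (Pt d) := {x | t ≤ f x}

/-- Modal-sets: connected sets `M` inside the support on which `f` is constant, and such that `f` is
strictly smaller on an envelope `{x : d(x, M) ≤ r}` outside `M`. -/
def IsModalSet (f : Pt d → ℝ) (M : Set (Pt d)) : Prop :=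
  M ⊆ tsupport f ∧ IsConnected M ∧
    ∃ fM : ℝ, (∀ x ∈ M, f x = fM) ∧ ∃ r > 0, ∀ x ∈ Metric.cthickening r M \ M, f x < fM

/-- `f_M = sup_{x ∈ M} f x`. -/
def height (f : Pt d → ℝ) (M : Set (Pt d)) : ℝ := sSup (f '' M)

/-- `ε₀`-modal sets: `f_M > ε₀` and `M` is a connected component of `{f ≥ f_M - ε₀}`. -/
def IsEpsModalSet (f : Pt d → ℝ) (ε₀ : ℝ) (M : Set (Pt d)) : Prop :=
  ε₀ < height f M ∧ ∃ x ∈ M, M = connectedComponentIn (levelSet f (height f M - ε₀)) x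

/-- `f` is a continuous, compactly supported probability density with finitely many modal-sets, all
in the interior of the support, and every connected component of a level set `{f ≥ t}`, `t > 0`,
contains a modal-set. The last clause says that the local maxima of `f` really are organised in
modal-sets; it excludes, for instance, a Cantor set of maximizers, no point of which lies in a
modal-set. -/
structure ModalDensity (f : Pt d → ℝ) : Prop where
  nonneg : ∀ x, 0 ≤ f x
  integral_eq_one : ∫ x, f x = 1
  continuous : Continuous f
  compact_support : HasCompactSupport f
  finite_modal : {M | IsModalSet f M}.Finite
  modal_interior : ∀ M, IsModalSet f M → M ⊆ interior (tsupport f)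
  modal_in_component : ∀ t, 0 < t → ∀ x ∈ levelSet f t,
    ∃ M, IsModalSet f M ∧ M ⊆ connectedComponentIn (levelSet f t) x

/-- The condition relating `f` to the tolerance `ε₀ ≥ 0`: `ε₀`-modal sets lie in the interior of the
support and have `f_M ≥ 2 ε₀`, and `f` exceeds `ε₀` somewhere on each connected component of
`{f > 0}` (an empty requirement if `ε₀ = 0`). -/
structure EpsDensity (f : Pt d → ℝ) (ε₀ : ℝ) : Prop where
  nonneg : 0 ≤ ε₀
  interior : ∀ M, IsEpsModalSet f ε₀ M → M ⊆ interior (tsupport f)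
  two_mul_le : ∀ M, IsEpsModalSet f ε₀ M → 2 * ε₀ ≤ height f M
  exceeds : ∀ x, 0 < f x → ∃ y ∈ connectedComponentIn {z | 0 < f z} x, ε₀ < f y

/-- The law of one sample point. -/
def law (f : Pt d → ℝ) : Measure (Pt d) := volume.withDensity fun x => ENNReal.ofReal (f x)

/-! ### Nearest-neighbour density estimate, graph and algorithm

A sample of size `n` is a map `X : Fin n → Pt d`; sets of sample points are represented by the
sets of their indices (sample points are almost surely distinct). -/

/-- `v_d`, the volume of the unit ball. -/
def unitVol (d : ℕ) : ℝ := (volume (Metric.closedBall (0 : Pt d) 1)).toReal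

/-- `C_{δ,n} = 16 log(2/δ) √(d log n)`. -/
def Cdn (d : ℕ) (δ : ℝ) (n : ℕ) : ℝ := 16 * Real.log (2 / δ) * √(d * Real.log n)

/-- `β_k = 4 C_{δ,n} / √k`. -/
def beta (d : ℕ) (δ : ℝ) (n k : ℕ) : ℝ := 4 * (Cdn d δ n / √(k : ℝ))

/-- `r_k(x)`: the least radius of a closed ball around `x` with at least `k` sample points
(the minimum exists if `1 ≤ k ≤ n`). -/
def rk {n : ℕ} (X : Fin n → Pt d) (k : ℕ) (x : Pt d) : ℝ :=
  sInf {r : ℝ | 0 ≤ r ∧ k ≤ Set.ncard {i | X i ∈ Metric.closedBall x r}}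

/-- The `k`-NN density estimate `f_k(x) = k / (n v_d r_k(x)^d)`. -/
def fk {n : ℕ} (X : Fin n → Pt d) (k : ℕ) (x : Pt d) : ℝ :=
  k / (n * unitVol d * rk X k x ^ d)

/-- The mutual `k`-NN graph `G(t)`. Indices outside its vertex set `{i : f_k(X i) ≥ t}` are isolated
here; they play no role. -/
def knnGraph {n : ℕ} (X : Fin n → Pt d) (k : ℕ) (t : ℝ) : SimpleGraph (Fin n) where
  Adj i j := i ≠ j ∧ t ≤ fk X k (X i) ∧ t ≤ fk X k (X j) ∧
    ‖X i - X j‖ ≤ min (rk X k (X i)) (rk X k (X j))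
  symm := ⟨fun i j h => ⟨h.1.symm, h.2.2.1, h.2.1, by
    rw [norm_sub_rev, min_comm]; exact h.2.2.2⟩⟩
  loopless := ⟨fun _ h => h.1 rfl⟩

/-- The connected component of `X i` in `G(t)`. -/
def component {n : ℕ} (X : Fin n → Pt d) (k : ℕ) (t : ℝ) (i : Fin n) : Set (Fin n) :=
  {j | (knnGraph X k t).Reachable i j}

open Classical in
/-- One round of the algorithm at the sample point `X i`. The state lists the cluster-cores found so
far, each with the level at which it was chosen. -/
def step {n : ℕ} (δ ε₀ εt : ℝ) (X : Fin n → Pt d) (k : ℕ)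
    (L : List (ℝ × Set (Fin n))) (i : Fin n) : List (ℝ × Set (Fin n)) :=
  let lam := fk X k (X i)
  let A := component X k (lam - 9 * beta d δ n k * lam - ε₀ - εt) i
  if ∀ e ∈ L, Disjoint A e.2 then
    (lam, {j ∈ A | lam - beta d δ n k * lam - ε₀ < fk X k (X j)}) :: L
  else L

/-- `σ` enumerates the sample points in decreasing order of `f_k` (ties broken arbitrarily). -/
def IsSorting {n : ℕ} (X : Fin n → Pt d) (k : ℕ) (σ : Equiv.Perm (Fin n)) : Prop :=
  Antitone fun i => fk X k (X (σ i))

/-- The estimates returned by the algorithm M-cores, each with the level at which it was chosen. -/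
def estimates {n : ℕ} (δ ε₀ εt : ℝ) (X : Fin n → Pt d) (k : ℕ) (σ : Equiv.Perm (Fin n)) :
    List (ℝ × Set (Fin n)) :=
  ((List.finRange n).map σ).foldl (step δ ε₀ εt X k) []

/-! ### Admissibility -/

/-- `A` and `A'` are `r`-separated by `S`: every path from `A` to `A'` crosses `S`, and
`sup_{B(S, r)} f < inf_{A ∪ A'} f`. -/
def SeparatedBy (f : Pt d → ℝ) (r : ℝ) (A A' S : Set (Pt d)) : Prop :=
  (∀ x ∈ A, ∀ y ∈ A', ∀ γ : Path x y, ∃ s, γ s ∈ S) ∧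
    ∃ a b : ℝ, a < b ∧ (∀ x ∈ Metric.cthickening r S, f x ≤ a) ∧ ∀ x ∈ A ∪ A', b ≤ f x

/-- The local geometry of `f` around the `ε₀`-modal set `M`: a component `A` of a level set
`{f ≥ lam}` isolating `M` by a valley around `S`, an envelope of radius `rM`, and moduli `l`, `u`
for the curvature and the smoothness of `f` around `M`. -/
structure LocalGeometry (f : Pt d → ℝ) (ε₀ rs : ℝ) (M : Set (Pt d))
    (lam rM : ℝ) (A S M₀ : Set (Pt d)) (l u : ℝ → ℝ) : Prop where
  component : ∃ x ∈ M, A = connectedComponentIn (levelSet f lam) x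
  subset : M ⊆ A
  isolates : ∀ M', IsEpsModalSet f ε₀ M' → M' ≠ M → Disjoint A M'
  separated : SeparatedBy f rs A (levelSet f lam \ A) S
  rM_pos : 0 < rM
  envelope : Metric.cthickening rM M ⊆ A
  l_cont : ContinuousOn l (Set.Icc 0 rM)
  u_cont : ContinuousOn u (Set.Icc 0 rM)
  l_mono : StrictMonoOn l (Set.Icc 0 rM)
  u_mono : StrictMonoOn u (Set.Icc 0 rM)
  l_zero : l 0 = 0
  u_zero : u 0 = 0
  peak_modal : IsModalSet f M₀
  peak_subset : M₀ ⊆ M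
  peak_height : ∀ x ∈ M₀, f x = height f M
  peak_smooth : ∀ x ∈ Metric.cthickening rM M₀, height f M - f x ≤ u (Metric.infDist x M₀)
  curvature : ∀ x ∈ Metric.cthickening rM M \ M, l (Metric.infDist x M) ≤ height f M - ε₀ - f x
  smooth : ∀ x ∈ Metric.cthickening rM M \ M, height f M - ε₀ - f x ≤ u (Metric.infDist x M)

/-- `k` is admissible for the `ε₀`-modal set `M`, with separation radius `rs`. The number `s` is
`u_M⁻¹ (C_{δ,n} (f_M - ε₀) / (2 √k))`. -/
def Admissible (f : Pt d → ℝ) (δ ε₀ εt rs : ℝ) (n k : ℕ) (M : Set (Pt d)) : Prop :=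
  ∃ (lam rM : ℝ) (A S M₀ : Set (Pt d)) (l u : ℝ → ℝ),
    LocalGeometry f ε₀ rs M lam rM A S M₀ l u ∧
    εt < l (min rM rs / 2) ∧
    max ((24 * Cdn d δ n * ((⨆ x, f x) + ε₀) / (l (min rM rs / 2) - εt)) ^ 2)
      ((2 : ℝ) ^ (7 + d) * Cdn d δ n ^ 2) ≤ k ∧
    ∃ s ∈ Set.Icc 0 rM, u s = Cdn d δ n * (height f M - ε₀) / (2 * √(k : ℝ)) ∧
      (k : ℝ) ≤ unitVol d * (height f M - ε₀) / 2 ^ (2 + 2 * d) * s ^ d * n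

/-! ### The pruning guarantee for a given sample -/

/-- The `ε₀`-modal sets `M` with `f_M ≥ min {f x : x a sample point, f_k(x) ≥ t - β_k t}`. -/
def targets {n : ℕ} (f : Pt d → ℝ) (δ ε₀ : ℝ) (X : Fin n → Pt d) (k : ℕ) (t : ℝ) :
    Set (Set (Pt d)) :=
  {M | IsEpsModalSet f ε₀ M ∧
    ∃ j, t - beta d δ n k * t ≤ fk X k (X j) ∧ f (X j) ≤ height f M}

/-- For every way to sort the sample and every `t ≥ lam₀`: if `k` is admissible for all sets in
`targets t` (with a separation radius `rs` common to all of them), then the estimates chosen at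
levels `≥ t` can be mapped injectively to `ε₀`-modal sets, an estimate chosen at level `lam` being
mapped into `targets lam`. -/
def PruningHolds {n : ℕ} (f : Pt d → ℝ) (δ ε₀ εt : ℝ) (k : ℕ) (lam₀ : ℝ) (X : Fin n → Pt d) :
    Prop :=
  ∀ σ : Equiv.Perm (Fin n), IsSorting X k σ → ∀ t, lam₀ ≤ t →
    (∃ rs > 0, ∀ M ∈ targets f δ ε₀ X k t, Admissible f δ ε₀ εt rs n k M) →
    ∃ Φ : ℝ × Set (Fin n) → Set (Pt d),
      Set.InjOn Φ {e | e ∈ estimates δ ε₀ εt X k σ ∧ t ≤ e.1} ∧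
      ∀ e ∈ estimates δ ε₀ εt X k σ, t ≤ e.1 → Φ e ∈ targets f δ ε₀ X k e.1

/-! ### For `ε₀ = 0`, `ε₀`-modal sets are exactly the modal-sets -/

theorem eq_of_modal {f : Pt d → ℝ} {M T : Set (Pt d)} {c r : ℝ} (hM : M.Nonempty) (hr : 0 < r)
    (h : ∀ x ∈ Metric.cthickening r M \ M, f x < c)
    (hcl : IsClosed M) (hT : IsPreconnected T) (hMT : M ⊆ T) (hTc : ∀ x ∈ T, c ≤ f x) :
    T = M := by
  refine Set.Subset.antisymm ?_ hMT
  have key : ∀ x ∈ T, x ∈ Metric.thickening r M → x ∈ M := by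
    intro x hx hxr
    by_contra hxM
    exact absurd (h x ⟨Metric.thickening_subset_cthickening r M hxr, hxM⟩) (not_lt.2 (hTc x hx))
  have hsub : M ⊆ Metric.thickening r M := Metric.self_subset_thickening hr M
  rcases isPreconnected_iff_subset_of_disjoint.1 hT (Metric.thickening r M) Mᶜ
    Metric.isOpen_thickening hcl.isOpen_compl
    (fun x _ => by by_cases hx : x ∈ M
                   · exact Or.inl (hsub hx)
                   · exact Or.inr hx)
    (by
      ext x
      simp only [Set.mem_inter_iff, Set.mem_compl_iff, Set.mem_empty_iff_false, iff_false]
      rintro ⟨hx, hxr, hxM⟩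
      exact hxM (key x hx hxr)) with h1 | h1
  · exact fun x hx => key x hx (h1 hx)
  · obtain ⟨x, hx⟩ := hM
    exact absurd hx (h1 (hMT hx))

theorem isClosed_of_modal {f : Pt d → ℝ} (hf : Continuous f) {M : Set (Pt d)} {c r : ℝ}
    (hc : ∀ x ∈ M, f x = c) (h : ∀ x ∈ Metric.cthickening r M \ M, f x < c) : IsClosed M := by
  refine isClosed_of_closure_subset fun x hx => ?_
  by_contra hxM
  have h1 : f x = c :=
    closure_minimal (fun y hy => hc y hy) (isClosed_eq hf continuous_const) hx
  exact absurd (h x ⟨Metric.closure_subset_cthickening r M hx, hxM⟩) (by simp [h1])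

theorem height_eq {f : Pt d → ℝ} {M : Set (Pt d)} {c : ℝ} (hM : M.Nonempty)
    (hc : ∀ x ∈ M, f x = c) : height f M = c := by
  have : f '' M = {c} := by
    ext y
    constructor
    · rintro ⟨x, hx, rfl⟩
      exact hc x hx
    · rintro rfl
      obtain ⟨x, hx⟩ := hM
      exact ⟨x, hx, hc x hx⟩
  rw [height, this, csSup_singleton]

theorem isEpsModalSet_zero_iff {f : Pt d → ℝ} (hf : ModalDensity f) (M : Set (Pt d)) :
    IsEpsModalSet f 0 M ↔ IsModalSet f M := by
  constructor
  · rintro ⟨hpos, x, hxM, hM⟩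
    rw [sub_zero] at hM
    have hxL : x ∈ levelSet f (height f M) := connectedComponentIn_subset _ _ (hM ▸ hxM)
    obtain ⟨M', hM', hsub⟩ := hf.modal_in_component _ hpos x hxL
    rw [← hM] at hsub
    have hbdd : BddAbove (f '' M) :=
      (hf.compact_support.isCompact_range hf.continuous).bddAbove.mono (Set.image_subset_range _ _)
    have hval : ∀ y ∈ M, f y = height f M := fun y hy =>
      le_antisymm (le_csSup hbdd ⟨y, hy, rfl⟩)
        (connectedComponentIn_subset (levelSet f (height f M)) x (hM ▸ hy))
    have hM'' := hM'
    obtain ⟨-, hconn, c, hc, r, hr, h⟩ := hM'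
    have hcv : c = height f M := by
      obtain ⟨y, hy⟩ := hconn.nonempty
      rw [← hc y hy, hval y (hsub hy)]
    have : M = M' := eq_of_modal hconn.nonempty hr h (isClosed_of_modal hf.continuous hc h)
      (by rw [hM]; exact isPreconnected_connectedComponentIn) hsub
      (fun y hy => by rw [hcv, hval y hy])
    rw [this]
    exact hM''
  · rintro ⟨hsupp, hconn, c, hc, r, hr, h⟩
    have hcl := isClosed_of_modal hf.continuous hc h
    have hht := height_eq hconn.nonempty hc
    obtain ⟨x, hx⟩ := hconn.nonempty
    have hc0 : 0 < c := by
      rcases (hf.nonneg x).lt_or_eq with h0 | h0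
      · rwa [← hc x hx]
      · exfalso
        have hcz : c = 0 := by rw [← hc x hx, ← h0]
        have huniv : (Set.univ : Set (Pt d)) = M := eq_of_modal hconn.nonempty hr h hcl
          isPreconnected_univ (Set.subset_univ _) (fun y _ => by rw [hcz]; exact hf.nonneg y)
        have hfz : f = 0 := by
          funext y
          rw [hc y (huniv ▸ Set.mem_univ y), hcz]
          rfl
        have := hsupp hx
        simp [hfz] at this
    refine ⟨by rwa [hht], x, hx, ?_⟩
    rw [sub_zero, hht]
    have hML : M ⊆ levelSet f c := fun y hy => (hc y hy).ge
    exact (eq_of_modal hconn.nonempty hr h hcl isPreconnected_connectedComponentIn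
      (hconn.isPreconnected.subset_connectedComponentIn hx hML)
      (fun y hy => connectedComponentIn_subset (levelSet f c) x hy)).symm

end MCores

end

/-!
The proof compares the graph on the sample with the level sets of `f`, at the scale of the
`k`-nearest-neighbour radii. Put `κ = β_k / 4 = C_{δ,n} / √k`.

*Typical samples.* For fixed `n` and `k` no uniform convergence over all balls is needed: by
Chernoff's bound, applied conditionally on each sample point (`rankCount_upper_tail`,
`rankCount_lower_tail`), the smallest ball around a sample point with `k` sample points has mass
`(1 ± 2 κ) k / n`, and every ball around a point of a fixed net with mass at least
`2⁻ᵈ k / (8 n)` contains a sample point. All this holds with probability at least `1 - δ`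
(`measure_not_typicalSample_le`, `failure_bound`) once `k ≥ 2 ^ (7 + d) C_{δ,n}²`, which is what
admissibility is used for.

*Resolved levels.* A level `lam` is resolved (`Resolution`) if the oscillation of `f` on balls of
expected count a multiple of `k` is at most a small fraction of `κ η`, where `η > 0` is a height at
which points of height `lam / 2` are connected whenever they are connected in `{f > 0}`; such an
`η` exists by compactness (`exists_uniform_connection`). At resolved levels `f_k` agrees with `f` up
to a factor `1 ± 3 κ`, and sample points in a connected subset of a level set are connected in a
`k`-NN graph at a slightly lower level (`reachable_of_preconnected`).

*Matching.* An estimate that arises from the sample point `x` is mapped to an `ε₀`-modal set which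
is at least as high as `x` and lies in the component of `x` in `{f ≥ f x - ε₀}`, or in `{f > 0}` if
the level of the graph is below `η / 2`. Two estimates with the same image arise from points that are
joined by a connected set through this image, so these points are connected in the graph that
belongs to the lower estimate (`reachable_of_isMatch`). But then the algorithm would have discarded
that estimate (`not_reachable_of_ne`).

*The threshold.* `lam₀ n k` is a resolved level within `1 / (n + 1)` of the infimum of all resolved
levels, levels above `2 sup f` being included since typical samples have no estimates there. For
Hölder continuous `f`, every positive level is eventually resolved (`eventually_resolution`).
-/

noncomputable section

namespace MCores

variable {d : ℕ}

/-! ### Level sets and their components -/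

theorem levelSet_anti {f : Pt d → ℝ} {a b : ℝ} (h : a ≤ b) : levelSet f b ⊆ levelSet f a :=
  fun _ hz => le_trans h hz

theorem isClosed_levelSet {f : Pt d → ℝ} (hf : Continuous f) (t : ℝ) : IsClosed (levelSet f t) :=
  isClosed_le continuous_const hf

theorem isCompact_levelSet {f : Pt d → ℝ} (hf : ModalDensity f) {t : ℝ} (ht : 0 < t) :
    IsCompact (levelSet f t) := by
  refine hf.compact_support.isCompact.of_isClosed_subset (isClosed_levelSet hf.continuous t) ?_
  intro x hx
  exact subset_tsupport f (ne_of_gt (lt_of_lt_of_le ht hx))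

theorem isClosed_connectedComponentIn {α : Type*} [TopologicalSpace α] {F : Set α} (hF : IsClosed F)
    (x : α) : IsClosed (connectedComponentIn F x) := by
  by_cases hx : x ∈ F
  · refine isClosed_of_closure_subset ?_
    refine isPreconnected_connectedComponentIn.closure.subset_connectedComponentIn
      (subset_closure (mem_connectedComponentIn hx)) ?_
    exact closure_minimal (connectedComponentIn_subset F x) hF
  · rw [connectedComponentIn_eq_empty hx]
    exact isClosed_empty

theorem connectedComponentIn_subset_of_mem {α : Type*} [TopologicalSpace α] {F G : Set α}
    (hFG : F ⊆ G) {x y : α} (hy : y ∈ connectedComponentIn G x) :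
    connectedComponentIn F y ⊆ connectedComponentIn G x := by
  rw [connectedComponentIn_eq hy]
  exact connectedComponentIn_mono y hFG

theorem mem_connectedComponentIn_of_preconnected {α : Type*} [TopologicalSpace α] {F U : Set α}
    {x y : α} (hU : IsPreconnected U) (hUF : U ⊆ F) (hx : x ∈ U) (hy : y ∈ U) :
    y ∈ connectedComponentIn F x :=
  hU.subset_connectedComponentIn hx hUF hy

theorem connectedComponentIn_symm {α : Type*} [TopologicalSpace α] {F : Set α}
    {x y : α} (h : y ∈ connectedComponentIn F x) : x ∈ connectedComponentIn F y := by
  rw [← connectedComponentIn_eq h]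
  exact mem_connectedComponentIn (connectedComponentIn_nonempty_iff.1 ⟨y, h⟩)

theorem connectedComponentIn_trans {α : Type*} [TopologicalSpace α] {F : Set α}
    {x y z : α} (h : y ∈ connectedComponentIn F x) (h' : z ∈ connectedComponentIn F y) :
    z ∈ connectedComponentIn F x := by
  rwa [connectedComponentIn_eq h]

/-- A point where `f` exceeds `ε₀` lies below an `ε₀`-modal set inside the component of
`{f ≥ f x - ε₀}` around it: take the component of `{f ≥ m - ε₀}` around a maximizer of `f` on the
former component, `m` being the maximum. -/
theorem exists_isEpsModalSet_subset {f : Pt d → ℝ} (hf : ModalDensity f) {ε₀ : ℝ} (hε₀ : 0 ≤ ε₀)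
    {x : Pt d} (hx : ε₀ < f x) :
    ∃ M, IsEpsModalSet f ε₀ M ∧ f x ≤ height f M ∧
      M ⊆ connectedComponentIn (levelSet f (f x - ε₀)) x := by
  have hs : 0 < f x - ε₀ := sub_pos.2 hx
  have hxL : x ∈ levelSet f (f x - ε₀) := by simp only [levelSet, Set.mem_ofPred_eq]; linarith
  have hcomp : IsCompact (connectedComponentIn (levelSet f (f x - ε₀)) x) :=
    (isCompact_levelSet hf hs).of_isClosed_subset
      (isClosed_connectedComponentIn (isClosed_levelSet hf.continuous _) x)
      (connectedComponentIn_subset _ _)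
  obtain ⟨y, hyT, hymax⟩ := hcomp.exists_isMaxOn ⟨x, mem_connectedComponentIn hxL⟩
    hf.continuous.continuousOn
  have hxy : f x ≤ f y := hymax (mem_connectedComponentIn hxL)
  have hyL : y ∈ levelSet f (f y - ε₀) := by simp only [levelSet, Set.mem_ofPred_eq]; linarith
  have hsub : connectedComponentIn (levelSet f (f y - ε₀)) y ⊆
      connectedComponentIn (levelSet f (f x - ε₀)) x := by
    refine connectedComponentIn_subset_of_mem ?_ hyT
    intro z hz
    simp only [levelSet, Set.mem_ofPred_eq] at hz ⊢
    linarith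
  have hheight : height f (connectedComponentIn (levelSet f (f y - ε₀)) y) = f y := by
    refine le_antisymm (csSup_le ⟨f y, y, mem_connectedComponentIn hyL, rfl⟩ ?_)
      (le_csSup ⟨f y, ?_⟩ ⟨y, mem_connectedComponentIn hyL, rfl⟩)
    · rintro _ ⟨z, hz, rfl⟩
      exact hymax (hsub hz)
    · rintro _ ⟨z, hz, rfl⟩
      exact hymax (hsub hz)
  refine ⟨connectedComponentIn (levelSet f (f y - ε₀)) y, ⟨?_, y, mem_connectedComponentIn hyL, ?_⟩,
    ?_, hsub⟩
  · rw [hheight]; linarith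
  · rw [hheight]
  · rw [hheight]; exact hxy

/-- A point of positive density lies below an `ε₀`-modal set inside its component of `{f > 0}`. -/
theorem exists_isEpsModalSet_subset_pos {f : Pt d → ℝ} (hf : ModalDensity f) {ε₀ : ℝ}
    (hε₀ : EpsDensity f ε₀) {x : Pt d} (hx : 0 < f x) :
    ∃ M, IsEpsModalSet f ε₀ M ∧ f x ≤ height f M ∧ M ⊆ connectedComponentIn {z | 0 < f z} x := by
  obtain ⟨y, hy, hyε, hxy⟩ : ∃ y ∈ connectedComponentIn {z | 0 < f z} x, ε₀ < f y ∧ f x ≤ f y := by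
    rcases lt_or_ge ε₀ (f x) with h | h
    · exact ⟨x, mem_connectedComponentIn hx, h, le_rfl⟩
    · obtain ⟨y, hy, hyε⟩ := hε₀.exceeds x hx
      exact ⟨y, hy, hyε, h.trans hyε.le⟩
  obtain ⟨M, hM, hMh, hMsub⟩ := exists_isEpsModalSet_subset hf hε₀.nonneg hyε
  refine ⟨M, hM, hxy.trans hMh, hMsub.trans (connectedComponentIn_subset_of_mem ?_ hy)⟩
  intro z hz
  simp only [levelSet, Set.mem_ofPred_eq] at hz ⊢
  linarith

theorem IsEpsModalSet.nonempty {f : Pt d → ℝ} {ε₀ : ℝ} {M : Set (Pt d)}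
    (hM : IsEpsModalSet f ε₀ M) : M.Nonempty := by
  obtain ⟨-, x, hx, -⟩ := hM
  exact ⟨x, hx⟩

theorem ModalDensity.exists_bound {f : Pt d → ℝ} (hf : ModalDensity f) :
    ∃ S : ℝ, 0 < S ∧ ∀ x, f x ≤ S := by
  obtain ⟨B, hB⟩ := (hf.compact_support.isCompact_range hf.continuous).bddAbove
  exact ⟨max B 1, by positivity, fun x => (hB ⟨x, rfl⟩).trans (le_max_left _ _)⟩

theorem ModalDensity.exists_pos {f : Pt d → ℝ} (hf : ModalDensity f) : ∃ x, 0 < f x := by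
  by_contra! h
  have : f = 0 := funext fun x => le_antisymm (h x) (hf.nonneg x)
  have h1 := hf.integral_eq_one
  simp [this] at h1

/-- Some `ε₀`-modal set is at least as high as every value of `f`. -/
theorem exists_isEpsModalSet_max {f : Pt d → ℝ} (hf : ModalDensity f) {ε₀ : ℝ}
    (hε₀ : EpsDensity f ε₀) : ∃ M, IsEpsModalSet f ε₀ M ∧ ∀ x, f x ≤ height f M := by
  obtain ⟨x₀, hx₀⟩ := hf.exists_pos
  obtain ⟨y, hyL, hy⟩ := (isCompact_levelSet hf hx₀).exists_isMaxOn ⟨x₀, le_refl (f x₀)⟩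
    hf.continuous.continuousOn
  obtain ⟨M, hM, hMh, -⟩ := exists_isEpsModalSet_subset_pos hf hε₀ (lt_of_lt_of_le hx₀ hyL)
  refine ⟨M, hM, fun x => ?_⟩
  rcases le_or_gt (f x₀) (f x) with h | h
  · exact (show f x ≤ f y from hy h).trans hMh
  · exact h.le.trans (le_trans hyL hMh)

/-- Points at height at least `t > 0` that share a component of `{f > 0}` already share a component
of `{f ≥ η}`, for a single `η > 0`. -/
theorem exists_uniform_connection {f : Pt d → ℝ} (hf : ModalDensity f) {t : ℝ} (ht : 0 < t) :
    ∃ η > 0, ∀ x y, t ≤ f x → t ≤ f y → y ∈ connectedComponentIn {z | 0 < f z} x →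
      y ∈ connectedComponentIn (levelSet f η) x := by
  have hopen : IsOpen {z | 0 < f z} := isOpen_lt continuous_const hf.continuous
  have hK := (isCompact_levelSet hf ht).prod (isCompact_levelSet hf ht)
  suffices h : ∃ η > 0, ∀ p ∈ levelSet f t ×ˢ levelSet f t,
      p.2 ∈ connectedComponentIn {z | 0 < f z} p.1 → p.2 ∈ connectedComponentIn (levelSet f η) p.1 by
    obtain ⟨η, hη, h⟩ := h
    exact ⟨η, hη, fun x y hx hy => h (x, y) ⟨hx, hy⟩⟩
  refine hK.induction_on (p := fun s => ∃ η > 0, ∀ p ∈ s,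
      p.2 ∈ connectedComponentIn {z | 0 < f z} p.1 → p.2 ∈ connectedComponentIn (levelSet f η) p.1)
    ⟨1, one_pos, by simp⟩ ?_ ?_ ?_
  · rintro s s' hss' ⟨η, hη, h⟩
    exact ⟨η, hη, fun p hp => h p (hss' hp)⟩
  · rintro s s' ⟨η, hη, h⟩ ⟨η', hη', h'⟩
    refine ⟨min η η', lt_min hη hη', ?_⟩
    rintro p (hp | hp) hc
    · exact connectedComponentIn_mono _ (levelSet_anti (min_le_left _ _)) (h p hp hc)
    · exact connectedComponentIn_mono _ (levelSet_anti (min_le_right _ _)) (h' p hp hc)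
  · rintro ⟨z, w⟩ ⟨hz, hw⟩
    -- a ball around each point of positive density on which `f` is bounded away from zero
    have hball : ∀ z : Pt d, t ≤ f z → ∃ r > 0, Metric.ball z r ⊆ levelSet f (t / 2) := by
      intro z hz
      have : ∀ᶠ y in 𝓝 z, t / 2 < f y :=
        hf.continuous.continuousAt.eventually (lt_mem_nhds (by linarith))
      obtain ⟨r, hr, h⟩ := Metric.eventually_nhds_iff_ball.1 this
      exact ⟨r, hr, fun y hy => (h y hy).le⟩
    obtain ⟨r, hr, hzr⟩ := hball z hz
    obtain ⟨r', hr', hwr⟩ := hball w hw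
    have hmem : Metric.ball z r ×ˢ Metric.ball w r' ∈ 𝓝[levelSet f t ×ˢ levelSet f t] (z, w) :=
      mem_nhdsWithin_of_mem_nhds
        (prod_mem_nhds (Metric.ball_mem_nhds z hr) (Metric.ball_mem_nhds w hr'))
    have hposz : Metric.ball z r ⊆ {z | 0 < f z} := fun y hy =>
      lt_of_lt_of_le (half_pos ht) (hzr hy)
    have hposw : Metric.ball w r' ⊆ {z | 0 < f z} := fun y hy =>
      lt_of_lt_of_le (half_pos ht) (hwr hy)
    have conn : ∀ (c : Pt d) (ρ : ℝ) (F : Set (Pt d)), Metric.ball c ρ ⊆ F →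
        ∀ a ∈ Metric.ball c ρ, ∀ b ∈ Metric.ball c ρ, b ∈ connectedComponentIn F a :=
      fun c ρ F hF a ha b hb => mem_connectedComponentIn_of_preconnected
        (convex_ball c ρ).isPreconnected hF ha hb
    have hzz := Metric.mem_ball_self (x := z) hr
    have hww := Metric.mem_ball_self (x := w) hr'
    refine ⟨_, hmem, ?_⟩
    by_cases hzw : w ∈ connectedComponentIn {z | 0 < f z} z
    · have hco : IsConnected (connectedComponentIn {z | 0 < f z} z) :=
        isConnected_connectedComponentIn_iff.2 (lt_of_lt_of_le ht hz)
      have hpath := hopen.connectedComponentIn.isConnected_iff_isPathConnected.1 hco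
      obtain ⟨γ, hγ⟩ := hpath.joinedIn z
        (mem_connectedComponentIn (show 0 < f z from lt_of_lt_of_le ht hz)) w hzw
      obtain ⟨_, ⟨s₀, rfl⟩, hmin⟩ := (isCompact_range γ.continuous).exists_isMinOn
        (Set.range_nonempty γ) hf.continuous.continuousOn
      have hm : 0 < f (γ s₀) := connectedComponentIn_subset {z | 0 < f z} z (hγ s₀)
      refine ⟨min (t / 2) (f (γ s₀)), lt_min (by positivity) hm, ?_⟩
      rintro ⟨x, y⟩ ⟨hx, hy⟩ -
      have hsub1 : levelSet f (t / 2) ⊆ levelSet f (min (t / 2) (f (γ s₀))) :=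
        levelSet_anti (min_le_left _ _)
      have h1 := conn z r _ (hzr.trans hsub1) x hx z hzz
      have h2 : w ∈ connectedComponentIn (levelSet f (min (t / 2) (f (γ s₀)))) z := by
        refine mem_connectedComponentIn_of_preconnected (isPreconnected_range γ.continuous) ?_
          ⟨0, γ.source⟩ ⟨1, γ.target⟩
        rintro _ ⟨s, rfl⟩
        exact le_trans (b := f (γ s₀)) (min_le_right _ _) (hmin ⟨s, rfl⟩)
      have h3 := conn w r' _ (hwr.trans hsub1) w hww y hy
      exact connectedComponentIn_trans (connectedComponentIn_trans h1 h2) h3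
    · refine ⟨1, one_pos, ?_⟩
      rintro ⟨x, y⟩ ⟨hx, hy⟩ hxy
      refine absurd ?_ hzw
      exact connectedComponentIn_trans (connectedComponentIn_trans
        (conn z r _ hposz z hzz x hx) hxy) (conn w r' _ hposw y hy w hww)

/-- A finite cover of a preconnected set by closed sets is linked: if two of its members that meet
always belong to the same class of an equivalence relation, then any two members that contain
points of the set do. -/
theorem rel_of_finite_closed_cover {α ι : Type*} [TopologicalSpace α] [Finite ι] {U : Set α}
    (hU : IsPreconnected U) {D : ι → Set α} (hD : ∀ i, IsClosed (D i)) (hcov : U ⊆ ⋃ i, D i)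
    {r : ι → ι → Prop} (hr : Equivalence r)
    (hlink : ∀ i j, ∀ y ∈ U, y ∈ D i → y ∈ D j → r i j) {i j : ι} {x y : α}
    (hx : x ∈ U) (hxi : x ∈ D i) (hy : y ∈ U) (hyj : y ∈ D j) : r i j := by
  by_contra hij
  have hA : IsClosed (⋃ a ∈ {a | r i a}, D a) :=
    (Set.toFinite _).isClosed_biUnion fun a _ => hD a
  have hB : IsClosed (⋃ a ∈ {a | ¬ r i a}, D a) :=
    (Set.toFinite _).isClosed_biUnion fun a _ => hD a
  obtain ⟨z, hzU, hzA, hzB⟩ := isPreconnected_closed_iff.1 hU _ _ hA hB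
    (fun z hz => by
      obtain ⟨a, ha⟩ := Set.mem_iUnion.1 (hcov hz)
      by_cases h : r i a
      · exact Or.inl (Set.mem_biUnion h ha)
      · exact Or.inr (Set.mem_biUnion h ha))
    ⟨x, hx, Set.mem_biUnion (hr.refl i) hxi⟩ ⟨y, hy, Set.mem_biUnion hij hyj⟩
  obtain ⟨a, ha, hza⟩ := Set.mem_iUnion₂.1 hzA
  obtain ⟨b, hb, hzb⟩ := Set.mem_iUnion₂.1 hzB
  exact hb (hr.trans ha (hlink a b z hzU hza hzb))

/-! ### The nearest-neighbour radius -/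

theorem rk_nonneg {n : ℕ} (X : Fin n → Pt d) (k : ℕ) (x : Pt d) : 0 ≤ rk X k x :=
  Real.sInf_nonneg fun _ h => h.1

theorem ncard_closedBall_mono {n : ℕ} (X : Fin n → Pt d) (x : Pt d) {r r' : ℝ} (h : r ≤ r') :
    Set.ncard {i | X i ∈ Metric.closedBall x r} ≤ Set.ncard {i | X i ∈ Metric.closedBall x r'} :=
  Set.ncard_le_ncard (fun _ hi => Metric.closedBall_subset_closedBall h hi) (Set.toFinite _)

theorem ncard_lt_of_lt_rk {n : ℕ} {X : Fin n → Pt d} {k : ℕ} {x : Pt d} {r : ℝ} (h0 : 0 ≤ r)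
    (h : r < rk X k x) : Set.ncard {i | X i ∈ Metric.closedBall x r} < k := by
  by_contra! hk
  exact absurd (csInf_le (s := {r : ℝ | 0 ≤ r ∧ k ≤ Set.ncard {i | X i ∈ Metric.closedBall x r}})
    ⟨0, fun _ hs => hs.1⟩ ⟨h0, hk⟩) (not_le.2 h)

theorem le_ncard_of_rk_lt {n : ℕ} {X : Fin n → Pt d} {k : ℕ} (hk : k ≤ n) {x : Pt d} {r : ℝ}
    (h : rk X k x < r) : k ≤ Set.ncard {i | X i ∈ Metric.closedBall x r} := by
  have hne : {r : ℝ | 0 ≤ r ∧ k ≤ Set.ncard {i | X i ∈ Metric.closedBall x r}}.Nonempty := by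
    refine ⟨∑ i, dist (X i) x, Finset.sum_nonneg fun i _ => dist_nonneg, ?_⟩
    have : {i | X i ∈ Metric.closedBall x (∑ i, dist (X i) x)} = Set.univ := by
      ext i
      simp only [Metric.mem_closedBall, Set.mem_ofPred_eq, Set.mem_univ, iff_true]
      exact Finset.single_le_sum (f := fun i => dist (X i) x) (fun i _ => dist_nonneg)
        (Finset.mem_univ i)
    rw [this, Set.ncard_univ, Nat.card_eq_fintype_card, Fintype.card_fin]
    exact hk
  obtain ⟨r', hr', hlt⟩ := exists_lt_of_csInf_lt hne h
  exact hr'.2.trans (ncard_closedBall_mono X x hlt.le)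

/-! ### Invariants of the algorithm -/

/-- The level of an estimate is the density estimate at a sample point, which belongs to the
estimate unless the tolerances vanish. -/
theorem exists_mem_of_mem_estimates {n : ℕ} {δ ε₀ εt : ℝ} {X : Fin n → Pt d} {k : ℕ}
    {σ : Equiv.Perm (Fin n)} {e : ℝ × Set (Fin n)} (he : e ∈ estimates δ ε₀ εt X k σ) :
    ∃ i, fk X k (X i) = e.1 ∧ (0 < beta d δ n k * e.1 + ε₀ → i ∈ e.2) := by
  set Q : ℝ × Set (Fin n) → Prop := fun e =>
    ∃ i, fk X k (X i) = e.1 ∧ (0 < beta d δ n k * e.1 + ε₀ → i ∈ e.2)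
  suffices h : ∀ (l : List (Fin n)) (L : List (ℝ × Set (Fin n))), (∀ e ∈ L, Q e) →
      ∀ e ∈ l.foldl (step δ ε₀ εt X k) L, Q e from h _ [] (by simp) e he
  intro l
  induction l with
  | nil => intro L hL; exact hL
  | cons i l ih =>
    intro L hL
    refine ih _ ?_
    intro e he
    unfold step at he
    simp only at he
    split_ifs at he with hc
    · rcases List.mem_cons.1 he with rfl | he
      · exact ⟨i, rfl, fun h => ⟨SimpleGraph.Reachable.refl i, by linarith⟩⟩
      · exact hL e he
    · exact hL e he

/-- Of two distinct estimates, the one at the lower level was chosen later, so its points are not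
connected to those of the other one in the graph in which it was formed. -/
theorem not_reachable_of_ne {n : ℕ} {δ ε₀ εt : ℝ} {X : Fin n → Pt d} {k : ℕ}
    {σ : Equiv.Perm (Fin n)} (hσ : IsSorting X k σ) {e e' : ℝ × Set (Fin n)}
    (he : e ∈ estimates δ ε₀ εt X k σ) (he' : e' ∈ estimates δ ε₀ εt X k σ) (hne : e ≠ e') :
    (e.1 ≤ e'.1 ∧ ∀ i ∈ e.2, ∀ j ∈ e'.2,
      ¬ (knnGraph X k (e.1 - 9 * beta d δ n k * e.1 - ε₀ - εt)).Reachable i j) ∨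
    (e'.1 ≤ e.1 ∧ ∀ i ∈ e'.2, ∀ j ∈ e.2,
      ¬ (knnGraph X k (e'.1 - 9 * beta d δ n k * e'.1 - ε₀ - εt)).Reachable i j) := by
  set R : ℝ × Set (Fin n) → ℝ × Set (Fin n) → Prop := fun e e' => e.1 ≤ e'.1 ∧
    ∀ i ∈ e.2, ∀ j ∈ e'.2,
      ¬ (knnGraph X k (e.1 - 9 * beta d δ n k * e.1 - ε₀ - εt)).Reachable i j with hR
  suffices h : (estimates δ ε₀ εt X k σ).Pairwise R from by
    have h' : (estimates δ ε₀ εt X k σ).Pairwise fun a b => R a b ∨ R b a :=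
      h.imp fun h => Or.inl h
    have : Std.Symm fun a b => R a b ∨ R b a := ⟨fun _ _ h => h.symm⟩
    exact h'.forall he he' hne
  suffices h : ∀ (l : List (Fin n)) (L : List (ℝ × Set (Fin n))),
      (l.Pairwise fun i j => fk X k (X j) ≤ fk X k (X i)) →
      (∀ e ∈ L, ∀ i ∈ l, fk X k (X i) ≤ e.1) → L.Pairwise R →
      (l.foldl (step δ ε₀ εt X k) L).Pairwise R by
    refine h _ [] ?_ (by simp) List.Pairwise.nil
    rw [List.pairwise_map]
    exact (List.pairwise_lt_finRange n).imp fun h => hσ h.le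
  intro l
  induction l with
  | nil => intro L _ _ hL; exact hL
  | cons i l ih =>
    intro L hl hle hL
    rw [List.pairwise_cons] at hl
    refine ih _ hl.2 ?_ ?_
    · intro e he j hj
      unfold step at he
      simp only at he
      split_ifs at he with hc
      · rcases List.mem_cons.1 he with rfl | he
        · exact hl.1 j hj
        · exact hle e he j (List.mem_cons_of_mem _ hj)
      · exact hle e he j (List.mem_cons_of_mem _ hj)
    · unfold step
      simp only
      split_ifs with hc
      · refine List.pairwise_cons.2 ⟨?_, hL⟩
        intro e he
        refine ⟨hle e he i List.mem_cons_self, ?_⟩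
        rintro a ⟨ha, -⟩ b hb hab
        exact Set.disjoint_left.1 (hc e he) (SimpleGraph.Reachable.trans ha hab) hb
      · exact hL

/-! ### Masses of balls -/

theorem unitVol_pos (d : ℕ) : 0 < unitVol d :=
  ENNReal.toReal_pos (Metric.measure_closedBall_pos volume _ one_pos).ne'
    measure_closedBall_lt_top.ne

theorem volume_real_closedBall (x : Pt d) {r : ℝ} (hr : 0 ≤ r) :
    volume.real (Metric.closedBall x r) = unitVol d * r ^ d := by
  rw [Measure.addHaar_real_closedBall' volume x hr, finrank_euclideanSpace_fin, mul_comm]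
  rfl

theorem isProbabilityMeasure_law {f : Pt d → ℝ} (hf : ModalDensity f) :
    IsProbabilityMeasure (law f) := by
  refine ⟨?_⟩
  have hint : Integrable f := hf.continuous.integrable_of_hasCompactSupport hf.compact_support
  rw [law, withDensity_apply _ MeasurableSet.univ, Measure.restrict_univ,
    ← ofReal_integral_eq_lintegral_ofReal hint (ae_of_all _ hf.nonneg), hf.integral_eq_one,
    ENNReal.ofReal_one]

theorem law_real_le {f : Pt d → ℝ} {s : Set (Pt d)} (hs : MeasurableSet s) (hfin : volume s ≠ ⊤)
    {b : ℝ} (hb : 0 ≤ b) (h : ∀ z ∈ s, f z ≤ b) :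
    (law f).real s ≤ volume.real s * b := by
  rw [Measure.real, Measure.real, law, withDensity_apply _ hs, mul_comm,
    ← ENNReal.toReal_ofReal hb, ← ENNReal.toReal_mul]
  refine ENNReal.toReal_mono (ENNReal.mul_ne_top ENNReal.ofReal_ne_top hfin) ?_
  rw [← setLIntegral_const]
  exact setLIntegral_mono' hs fun z hz => ENNReal.ofReal_le_ofReal (h z hz)

theorem le_law_real {f : Pt d → ℝ} (hf : ModalDensity f) {s : Set (Pt d)} (hs : MeasurableSet s)
    {b : ℝ} (hb : 0 ≤ b) (h : ∀ z ∈ s, b ≤ f z) :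
    volume.real s * b ≤ (law f).real s := by
  have := isProbabilityMeasure_law hf
  have h1 : ENNReal.ofReal b * volume s ≤ law f s := by
    rw [law, withDensity_apply _ hs, ← setLIntegral_const]
    exact setLIntegral_mono' hs fun z hz => ENNReal.ofReal_le_ofReal (h z hz)
  have h2 := ENNReal.toReal_mono (measure_ne_top _ _) h1
  rw [ENNReal.toReal_mul, ENNReal.toReal_ofReal hb, mul_comm] at h2
  exact h2

/-- Around every point there are balls of every mass in `[0, 1)`. -/
def HasRadii (μ : Measure (Pt d)) : Prop :=
  ∀ x p, 0 ≤ p → p < 1 → ∃ r, 0 ≤ r ∧ μ.real (Metric.closedBall x r) = p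

theorem hasRadii_law {f : Pt d → ℝ} (hf : ModalDensity f) (hd : 0 < d) : HasRadii (law f) := by
  intro x p hp0 hp1
  have hprob := isProbabilityMeasure_law hf
  obtain ⟨S, hS, hfS⟩ := hf.exists_bound
  set φ : ℝ → ℝ := fun r => (law f).real (Metric.closedBall x r) with hφ
  obtain ⟨R, hR⟩ := hf.compact_support.isCompact.isBounded.subset_closedBall x
  have hR' : tsupport f ⊆ Metric.closedBall x (max R 0) :=
    hR.trans (Metric.closedBall_subset_closedBall (le_max_left _ _))
  have hφR : φ (max R 0) = 1 := by
    have h0 : law f (Metric.closedBall x (max R 0))ᶜ = 0 := by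
      rw [law, withDensity_apply _ measurableSet_closedBall.compl]
      refine (setLIntegral_congr_fun measurableSet_closedBall.compl fun z hz => ?_).trans
        lintegral_zero
      have : f z = 0 := image_eq_zero_of_notMem_tsupport fun h => hz (hR' h)
      simp [this]
    have := (prob_compl_eq_zero_iff measurableSet_closedBall).1 h0
    simp [hφ, Measure.real, this]
  have hφ0 : φ 0 ≤ 0 := by
    have := law_real_le (f := f) (measurableSet_closedBall (x := x) (ε := 0))
      measure_closedBall_lt_top.ne hS.le fun z _ => hfS z
    rwa [volume_real_closedBall x le_rfl, zero_pow hd.ne', mul_zero, zero_mul] at this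
  have hdiff : ∀ r r', 0 ≤ r → r ≤ r' → |φ r' - φ r| ≤ unitVol d * S * |r' ^ d - r ^ d| := by
    intro r r' hr hrr'
    have hsub : Metric.closedBall x r ⊆ Metric.closedBall x r' :=
      Metric.closedBall_subset_closedBall hrr'
    have h1 := measureReal_sdiff (μ := law f) hsub measurableSet_closedBall
    have h2 := measureReal_sdiff (μ := volume) hsub measurableSet_closedBall
      measure_closedBall_lt_top.ne
    rw [volume_real_closedBall x hr, volume_real_closedBall x (hr.trans hrr')] at h2
    have h3 := law_real_le (f := f) (s := Metric.closedBall x r' \ Metric.closedBall x r)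
      (measurableSet_closedBall.diff measurableSet_closedBall)
      (measure_ne_top_of_subset Set.sdiff_subset measure_closedBall_lt_top.ne)
      hS.le fun z _ => hfS z
    have h4 : φ r ≤ φ r' := measureReal_mono hsub
    have h5 : r ^ d ≤ r' ^ d := pow_le_pow_left₀ hr hrr' d
    rw [abs_of_nonneg (by linarith), abs_of_nonneg (by linarith), hφ]
    simp only
    rw [← h1]
    refine h3.trans (le_of_eq ?_)
    rw [h2]; ring
  have hdiff' : ∀ r r', 0 ≤ r → 0 ≤ r' →
      dist (φ r') (φ r) ≤ unitVol d * S * |r' ^ d - r ^ d| := by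
    intro r r' hr hr'
    rw [Real.dist_eq]
    rcases le_total r r' with h | h
    · exact hdiff r r' hr h
    · rw [abs_sub_comm, abs_sub_comm (r' ^ d)]
      exact hdiff r' r hr' h
  have hcont : ContinuousOn φ (Set.Icc 0 (max R 0)) := by
    intro r hr
    rw [ContinuousWithinAt, tendsto_iff_dist_tendsto_zero]
    have hlim : Tendsto (fun r' => unitVol d * S * |r' ^ d - r ^ d|)
        (𝓝[Set.Icc 0 (max R 0)] r) (𝓝 0) := by
      have hc : Continuous fun r' : ℝ => unitVol d * S * |r' ^ d - r ^ d| := by fun_prop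
      have := (hc.tendsto r).mono_left (nhdsWithin_le_nhds (s := Set.Icc 0 (max R 0)))
      simpa using this
    refine squeeze_zero' (Eventually.of_forall fun _ => dist_nonneg) ?_ hlim
    filter_upwards [self_mem_nhdsWithin] with r' hr'
    exact hdiff' r r' hr.1 hr'.1
  obtain ⟨r, hr, hrp⟩ := intermediate_value_Icc (le_max_right R 0) hcont
    ⟨hφ0.trans hp0, by rw [hφR]; exact hp1.le⟩
  exact ⟨r, hr.1, hrp⟩

/-- The mass of the closed ball around `x` whose boundary passes through `y`. If `y` has law `μ` and
`μ` satisfies `HasRadii`, it is uniformly distributed on `[0, 1]`. -/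
def massTo (μ : Measure (Pt d)) (x y : Pt d) : ℝ := μ.real (Metric.closedBall x (dist y x))

theorem massTo_le_one (μ : Measure (Pt d)) [IsProbabilityMeasure μ] (x y : Pt d) :
    massTo μ x y ≤ 1 := measureReal_le_one

theorem measurable_massTo (μ : Measure (Pt d)) [IsProbabilityMeasure μ] :
    Measurable (Function.uncurry (massTo μ)) := by
  have hs : MeasurableSet {q : (Pt d × Pt d) × Pt d | dist q.2 q.1.1 ≤ dist q.1.2 q.1.1} :=
    measurableSet_le (by fun_prop) (by fun_prop)
  exact (measurable_measure_prodMk_left (ν := μ) hs).ennreal_toReal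

theorem measurableSet_massTo_le (μ : Measure (Pt d)) [IsProbabilityMeasure μ] (x : Pt d) (p : ℝ) :
    MeasurableSet {y | massTo μ x y ≤ p} :=
  measurableSet_le (measurable_massTo μ).of_uncurry_left measurable_const

theorem measure_massTo_le {μ : Measure (Pt d)} [IsProbabilityMeasure μ] (hμ : HasRadii μ)
    (x : Pt d) {p : ℝ} (hp : 0 ≤ p) :
    μ.real {y | massTo μ x y ≤ p} ≤ p := by
  refine le_of_forall_gt_imp_ge_of_dense fun q hq => ?_
  rcases le_or_gt 1 q with h1 | h1
  · exact measureReal_le_one.trans h1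
  obtain ⟨r, hr, hrq⟩ := hμ x q (hp.trans hq.le) h1
  rw [← hrq]
  refine measureReal_mono fun y hy => ?_
  by_contra hyr
  rw [Metric.mem_closedBall, not_le] at hyr
  have : μ.real (Metric.closedBall x r) ≤ massTo μ x y :=
    measureReal_mono (Metric.closedBall_subset_closedBall hyr.le)
  have hy' : massTo μ x y ≤ p := hy
  linarith

theorem le_measure_massTo {μ : Measure (Pt d)} [IsProbabilityMeasure μ] (hμ : HasRadii μ)
    (x : Pt d) {p : ℝ} (hp : 0 ≤ p) (hp1 : p ≤ 1) :
    p ≤ μ.real {y | massTo μ x y ≤ p} := by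
  rcases hp1.lt_or_eq with h1 | rfl
  · obtain ⟨r, hr, hrq⟩ := hμ x p hp h1
    conv_lhs => rw [← hrq]
    refine measureReal_mono fun y hy => ?_
    rw [← hrq]
    exact measureReal_mono (Metric.closedBall_subset_closedBall hy)
  · have : {y | massTo μ x y ≤ 1} = Set.univ :=
      Set.eq_univ_of_forall fun y => massTo_le_one μ x y
    rw [this, probReal_univ]

/-! ### Concentration of counts -/

/-- The number of sample points `X j`, `j ≠ i`, with `massTo μ (X i) (X j) ≤ p`. -/
def rankCount {n : ℕ} (μ : Measure (Pt d)) (X : Fin n → Pt d) (i : Fin n) (p : ℝ) : ℕ :=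
  Set.ncard {j | j ≠ i ∧ massTo μ (X i) (X j) ≤ p}

theorem integral_exp_count {α : Type*} [MeasurableSpace α] (μ : Measure α) [IsProbabilityMeasure μ]
    {A : Set α} (hA : MeasurableSet A) (m : ℕ) (t : ℝ) :
    ProbabilityTheory.mgf (fun Y : Fin m → α => ∑ j, A.indicator 1 (Y j))
      (Measure.pi fun _ => μ) t ≤ Real.exp ((Real.exp t - 1) * (m * μ.real A)) := by
  have h1 : ∀ y, Real.exp (t * A.indicator 1 y) = 1 + (Real.exp t - 1) * A.indicator 1 y := by
    intro y
    by_cases hy : y ∈ A <;> simp [hy]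
  have h2 : ∫ y, Real.exp (t * A.indicator 1 y) ∂μ = 1 + (Real.exp t - 1) * μ.real A := by
    simp_rw [h1]
    have hi : Integrable (A.indicator (1 : α → ℝ)) μ := (integrable_const (1 : ℝ)).indicator hA
    rw [integral_add (integrable_const _) (hi.const_mul _),
      integral_const_mul, integral_indicator_one hA]
    simp
  have h3 : ProbabilityTheory.mgf (fun Y : Fin m → α => ∑ j, A.indicator 1 (Y j))
      (Measure.pi fun _ => μ) t = (1 + (Real.exp t - 1) * μ.real A) ^ m := by
    rw [ProbabilityTheory.mgf]
    simp_rw [Finset.mul_sum, Real.exp_sum]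
    rw [integral_fintype_prod_eq_pow (fun y => Real.exp (t * A.indicator 1 y)), h2, Fintype.card_fin]
  rw [h3, show (Real.exp t - 1) * (m * μ.real A) = m * ((Real.exp t - 1) * μ.real A) by ring,
    Real.exp_nat_mul]
  refine pow_le_pow_left₀ ?_ (by linarith [Real.add_one_le_exp ((Real.exp t - 1) * μ.real A)]) m
  have := measureReal_le_one (μ := μ) (s := A)
  nlinarith [Real.exp_pos t, measureReal_nonneg (μ := μ) (s := A)]

theorem integrable_exp_count {α : Type*} [MeasurableSpace α] (μ : Measure α)
    [IsProbabilityMeasure μ] {A : Set α} (hA : MeasurableSet A) (m : ℕ) (t : ℝ) :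
    Integrable (fun Y : Fin m → α => Real.exp (t * ∑ j, A.indicator 1 (Y j)))
      (Measure.pi fun _ => μ) := by
  simp_rw [Finset.mul_sum, Real.exp_sum]
  refine Integrable.fintype_prod (f := fun _ y => Real.exp (t * A.indicator 1 y))
    (μ := fun _ => μ) fun _ => ?_
  refine Integrable.of_bound (C := Real.exp |t|) ?_ (ae_of_all _ fun y => ?_)
  · exact (Real.measurable_exp.comp
      ((measurable_const.indicator hA).const_mul t)).aestronglyMeasurable
  · rw [Real.norm_eq_abs, Real.abs_exp]
    refine Real.exp_le_exp.2 ?_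
    by_cases hy : y ∈ A
    · simp [hy, le_abs_self]
    · simp [hy]

/-- Chernoff's bound for the upper tail of a binomial count. -/
theorem count_upper_tail {α : Type*} [MeasurableSpace α] (μ : Measure α) [IsProbabilityMeasure μ]
    {A : Set α} (hA : MeasurableSet A) (m : ℕ) {k D : ℝ} (hD1 : 1 ≤ D) (hDk : 2 * D ≤ k)
    (hm : m * μ.real A ≤ k - 2 * D) :
    (Measure.pi fun _ : Fin m => μ).real {Y | k - 1 ≤ ∑ j, A.indicator 1 (Y j)} ≤
      Real.exp (-(D ^ 2 / k) / 4) := by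
  have hk : 0 < k := by linarith
  set t := D / (2 * k) with ht
  have ht0 : 0 ≤ t := by positivity
  have ht1 : t ≤ 1 := by rw [ht, div_le_one (by positivity)]; linarith
  have hkt : 2 * k * t = D := by rw [ht]; field_simp
  refine (ProbabilityTheory.measure_ge_le_exp_mul_mgf (k - 1) ht0
    (integrable_exp_count μ hA m t)).trans ?_
  refine (mul_le_mul_of_nonneg_left (integral_exp_count μ hA m t) (Real.exp_nonneg _)).trans ?_
  rw [← Real.exp_add]
  refine Real.exp_le_exp.2 ?_
  have he := (abs_le.1 (Real.abs_exp_sub_one_sub_id_le (x := t) (by rwa [abs_of_nonneg ht0]))).2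
  have he0 : 0 ≤ Real.exp t - 1 := by linarith [Real.add_one_le_exp t]
  have h1 : (Real.exp t - 1) * (m * μ.real A) ≤ (t + t ^ 2) * (k - 2 * D) :=
    mul_le_mul (by linarith) hm (by positivity) (by positivity)
  have h2 : D ^ 2 / k = 4 * k * t ^ 2 := by rw [← hkt]; field_simp; ring
  rw [h2]
  nlinarith [mul_nonneg ht0 (sub_nonneg.2 hD1), mul_nonneg (sq_nonneg t) (by linarith : 0 ≤ D)]

/-- Chernoff's bound for the lower tail of a binomial count. -/
theorem count_lower_tail {α : Type*} [MeasurableSpace α] (μ : Measure α) [IsProbabilityMeasure μ]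
    {A : Set α} (hA : MeasurableSet A) (m : ℕ) {k D : ℝ} (hD1 : 1 ≤ D) (hDk : 2 * D ≤ k)
    (hm : k + 2 * D - 1 ≤ m * μ.real A) :
    (Measure.pi fun _ : Fin m => μ).real {Y | ∑ j, A.indicator 1 (Y j) ≤ k - 1} ≤
      Real.exp (-(D ^ 2 / k) / 4) := by
  have hk : 0 < k := by linarith
  set t := D / (2 * k) with ht
  have ht0 : 0 ≤ t := by positivity
  have ht1 : t ≤ 1 := by rw [ht, div_le_one (by positivity)]; linarith
  have hkt : 2 * k * t = D := by rw [ht]; field_simp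
  refine (ProbabilityTheory.measure_le_le_exp_mul_mgf (k - 1) (neg_nonpos.2 ht0)
    (integrable_exp_count μ hA m (-t))).trans ?_
  refine (mul_le_mul_of_nonneg_left (integral_exp_count μ hA m (-t)) (Real.exp_nonneg _)).trans ?_
  rw [← Real.exp_add]
  refine Real.exp_le_exp.2 ?_
  have he := (abs_le.1 (Real.abs_exp_sub_one_sub_id_le (x := -t)
    (by rwa [abs_neg, abs_of_nonneg ht0]))).2
  have h1 : (Real.exp (-t) - 1) * (m * μ.real A) ≤ (-t + t ^ 2) * (k + 2 * D - 1) := by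
    have h0 : 0 ≤ m * μ.real A := by positivity
    have h3 : (Real.exp (-t) - 1) * (m * μ.real A) ≤ (-t + t ^ 2) * (m * μ.real A) :=
      mul_le_mul_of_nonneg_right (by nlinarith) h0
    refine h3.trans (mul_le_mul_of_nonpos_left hm ?_)
    nlinarith
  have h2 : D ^ 2 / k = 4 * k * t ^ 2 := by rw [← hkt]; field_simp; ring
  rw [h2]
  nlinarith [mul_nonneg ht0 (sub_nonneg.2 hD1), mul_nonneg (sq_nonneg t) (sub_nonneg.2 hDk)]

open Classical in
theorem rankCount_eq_sum {m : ℕ} (μ : Measure (Pt d)) (X : Fin (m + 1) → Pt d) (i : Fin (m + 1))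
    (p : ℝ) : (rankCount μ X i p : ℝ) =
      ∑ j : Fin m, {y | massTo μ (X i) y ≤ p}.indicator 1 (X (i.succAbove j)) := by
  rw [rankCount, Set.ncard_eq_toFinset_card', Set.toFinset_ofPred, Finset.natCast_card_filter,
    Fin.sum_univ_succAbove _ i]
  simp [Set.indicator_apply, Fin.succAbove_ne]

/-- If, for every position `x` of `X i`, the other sample points satisfy a condition with
probability at most `ε`, then so does the whole sample. -/
theorem measure_pi_le_of_forall {m : ℕ} (μ : Measure (Pt d)) [IsProbabilityMeasure μ]
    (i : Fin (m + 1)) {T : Set (Pt d × (Fin m → Pt d))} (hT : MeasurableSet T) {ε : ℝ}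
    (h : ∀ x, (Measure.pi fun _ : Fin m => μ).real {Y | (x, Y) ∈ T} ≤ ε) :
    Measure.pi (fun _ : Fin (m + 1) => μ) {X | (X i, fun j => X (i.succAbove j)) ∈ T} ≤
      ENNReal.ofReal ε := by
  have hmp := measurePreserving_piFinSuccAbove (fun _ : Fin (m + 1) => μ) i
  have h1 := hmp.measure_preimage_equiv T
  have h2 : (MeasurableEquiv.piFinSuccAbove (fun _ : Fin (m + 1) => Pt d) i) ⁻¹' T =
      {X | (X i, fun j => X (i.succAbove j)) ∈ T} := rfl
  rw [h2] at h1
  rw [h1, Measure.prod_apply hT]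
  calc ∫⁻ x, (Measure.pi fun _ : Fin m => μ) (Prod.mk x ⁻¹' T) ∂μ
      ≤ ∫⁻ _, ENNReal.ofReal ε ∂μ := by
        refine lintegral_mono fun x => ?_
        rw [← ENNReal.ofReal_toReal (measure_ne_top (Measure.pi fun _ : Fin m => μ) _)]
        exact ENNReal.ofReal_le_ofReal (h x)
    _ = ENNReal.ofReal ε := by simp

open Classical in
theorem measurable_sum_massTo (μ : Measure (Pt d)) [IsProbabilityMeasure μ] (m : ℕ) (p : ℝ) :
    Measurable fun q : Pt d × (Fin m → Pt d) =>
      ∑ j : Fin m, {y | massTo μ q.1 y ≤ p}.indicator (1 : Pt d → ℝ) (q.2 j) := by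
  refine Finset.measurable_fun_sum _ fun j _ => ?_
  have h : Measurable fun q : Pt d × (Fin m → Pt d) => (q.1, q.2 j) :=
    measurable_fst.prodMk ((measurable_pi_apply j).comp measurable_snd)
  have h' := (measurable_massTo μ).comp h
  have hS := measurableSet_le h' (measurable_const (a := p))
  simp only [Set.indicator_apply, Set.mem_ofPred_eq, Pi.one_apply]
  exact Measurable.ite hS measurable_const measurable_const

theorem rankCount_upper_tail {n : ℕ} {μ : Measure (Pt d)} [IsProbabilityMeasure μ]
    (hμ : HasRadii μ) {k D : ℝ} (hD1 : 1 ≤ D) (hDk : 2 * D ≤ k) (i : Fin n) :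
    Measure.pi (fun _ : Fin n => μ) {X | k - 1 ≤ rankCount μ X i ((k - 2 * D) / n)} ≤
      ENNReal.ofReal (Real.exp (-(D ^ 2 / k) / 4)) := by
  obtain ⟨m, rfl⟩ : ∃ m, n = m + 1 := ⟨n - 1, by have := i.pos; omega⟩
  set p := (k - 2 * D) / ((m + 1 : ℕ) : ℝ) with hp
  have hp0 : 0 ≤ p := by have : 0 ≤ k - 2 * D := by linarith
                         positivity
  simp_rw [rankCount_eq_sum]
  refine measure_pi_le_of_forall μ i
    (T := {q | k - 1 ≤ ∑ j : Fin m, {y | massTo μ q.1 y ≤ p}.indicator (1 : Pt d → ℝ) (q.2 j)})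
    (measurableSet_le measurable_const (measurable_sum_massTo μ m p)) fun x => ?_
  refine count_upper_tail μ (measurableSet_massTo_le μ x p) m hD1 hDk ?_
  have h1 := measure_massTo_le hμ x hp0
  have h2 : ((m + 1 : ℕ) : ℝ) * p = k - 2 * D := by rw [hp]; field_simp
  push_cast at h2
  nlinarith [Nat.cast_nonneg (α := ℝ) m]

theorem rankCount_lower_tail {n : ℕ} {μ : Measure (Pt d)} [IsProbabilityMeasure μ]
    (hμ : HasRadii μ) {k D : ℝ} (hD1 : 1 ≤ D) (hDk : 2 * D ≤ k) (hkn : (k + 2 * D) / n ≤ 1)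
    (i : Fin n) :
    Measure.pi (fun _ : Fin n => μ) {X | (rankCount μ X i ((k + 2 * D) / n) : ℝ) ≤ k - 1} ≤
      ENNReal.ofReal (Real.exp (-(D ^ 2 / k) / 4)) := by
  obtain ⟨m, rfl⟩ : ∃ m, n = m + 1 := ⟨n - 1, by have := i.pos; omega⟩
  set p := (k + 2 * D) / ((m + 1 : ℕ) : ℝ) with hp
  have hp0 : 0 ≤ p := by have : 0 ≤ k + 2 * D := by linarith
                         positivity
  simp_rw [rankCount_eq_sum]
  refine measure_pi_le_of_forall μ i
    (T := {q | ∑ j : Fin m, {y | massTo μ q.1 y ≤ p}.indicator (1 : Pt d → ℝ) (q.2 j) ≤ k - 1})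
    (measurableSet_le (measurable_sum_massTo μ m p) measurable_const) fun x => ?_
  refine count_lower_tail μ (measurableSet_massTo_le μ x p) m hD1 hDk ?_
  have h1 := le_measure_massTo hμ x hp0 hkn
  have h2 : ((m + 1 : ℕ) : ℝ) * p = k + 2 * D := by rw [hp]; field_simp
  push_cast at h2
  nlinarith [Nat.cast_nonneg (α := ℝ) m]

/-! ### Typical samples -/

/-- A sample is typical if the mass of the smallest ball around a sample point with `k` sample
points lies between `a` and `b`, and if the balls around the points `y` of `Y` with radius `q y`
contain a sample point as soon as their mass is at least `p`. -/
structure TypicalSample {n : ℕ} (μ : Measure (Pt d)) (k : ℕ) (a b p : ℝ) (Y : Finset (Pt d))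
    (q : Pt d → ℝ) (X : Fin n → Pt d) : Prop where
  lower : ∀ i r, rk X k (X i) < r → a < μ.real (Metric.closedBall (X i) r)
  upper : ∀ i r, 0 ≤ r → r < rk X k (X i) → μ.real (Metric.closedBall (X i) r) ≤ b
  hits : ∀ y ∈ Y, p ≤ μ.real (Metric.closedBall y (q y)) → ∃ i, X i ∈ Metric.closedBall y (q y)

theorem le_rankCount_of_rk_lt {n : ℕ} {μ : Measure (Pt d)} [IsProbabilityMeasure μ]
    {X : Fin n → Pt d} {k : ℕ} (hk : k ≤ n) {i : Fin n} {r a : ℝ} (hr : rk X k (X i) < r)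
    (ha : μ.real (Metric.closedBall (X i) r) ≤ a) : k ≤ rankCount μ X i a + 1 := by
  refine (le_ncard_of_rk_lt hk hr).trans ?_
  refine le_trans (Set.ncard_le_ncard (t := insert i {j | j ≠ i ∧ massTo μ (X i) (X j) ≤ a}) ?_
    (Set.toFinite _)) (Set.ncard_insert_le _ _)
  intro j hj
  by_cases h : j = i
  · exact Or.inl h
  · exact Or.inr ⟨h, (measureReal_mono (Metric.closedBall_subset_closedBall hj)).trans ha⟩

theorem rankCount_lt_of_lt_rk {n : ℕ} {μ : Measure (Pt d)} [IsProbabilityMeasure μ]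
    {X : Fin n → Pt d} {k : ℕ} {i : Fin n} {r b : ℝ} (h0 : 0 ≤ r) (hr : r < rk X k (X i))
    (hb : b < μ.real (Metric.closedBall (X i) r)) : rankCount μ X i b + 1 < k := by
  refine lt_of_le_of_lt ?_ (ncard_lt_of_lt_rk h0 hr)
  rw [rankCount, ← Set.ncard_insert_of_notMem (a := i) (by simp)]
  refine Set.ncard_le_ncard ?_ (Set.toFinite _)
  rintro j (rfl | ⟨-, hj⟩)
  · exact Metric.mem_closedBall_self h0
  · by_contra hjr
    have h1 : r ≤ dist (X j) (X i) := (not_le.1 hjr).le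
    exact absurd (hb.trans_le ((measureReal_mono (Metric.closedBall_subset_closedBall h1)).trans hj))
      (lt_irrefl _)

theorem measure_pi_forall_notMem_le {n : ℕ} (μ : Measure (Pt d)) [IsProbabilityMeasure μ]
    {B : Set (Pt d)} (hB : MeasurableSet B) {p : ℝ} (hp : p ≤ μ.real B) :
    Measure.pi (fun _ : Fin n => μ) {X | ∀ i, X i ∉ B} ≤ ENNReal.ofReal (Real.exp (-(n * p))) := by
  have h1 : {X : Fin n → Pt d | ∀ i, X i ∉ B} = Set.univ.pi fun _ => Bᶜ := by
    ext X; simp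
  rw [h1, Measure.pi_pi]
  simp only [Finset.prod_const, Finset.card_univ, Fintype.card_fin]
  have h2 : μ Bᶜ ≤ ENNReal.ofReal (Real.exp (-p)) := by
    rw [← ENNReal.ofReal_toReal (measure_ne_top μ Bᶜ)]
    refine ENNReal.ofReal_le_ofReal ?_
    have := probReal_compl_eq_one_sub (μ := μ) hB
    rw [Measure.real] at this
    rw [this]
    linarith [Real.add_one_le_exp (-p)]
  refine (pow_le_pow_left₀ (zero_le) h2 n).trans (le_of_eq ?_)
  rw [← ENNReal.ofReal_pow (Real.exp_nonneg _), ← Real.exp_nat_mul]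
  ring_nf

/-- A sample fails to be typical with small probability. -/
theorem measure_not_typicalSample_le {n : ℕ} {μ : Measure (Pt d)} [IsProbabilityMeasure μ]
    (hμ : HasRadii μ) {k : ℕ} (hk : k ≤ n) {D p ε : ℝ} (hD1 : 1 ≤ D) (hDk : 2 * D ≤ k)
    (Y : Finset (Pt d)) (q : Pt d → ℝ) (hε : Real.exp (-(D ^ 2 / k) / 4) ≤ ε)
    (hp : Real.exp (-(n * p)) ≤ ε) :
    Measure.pi (fun _ : Fin n => μ)
      {X | ¬ TypicalSample μ k ((k - 2 * D) / n) ((k + 2 * D) / n) p Y q X} ≤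
      ENNReal.ofReal ((2 * n + Y.card) * ε) := by
  set P := Measure.pi (fun _ : Fin n => μ)
  set a := (k - 2 * D) / (n : ℝ)
  set b := (k + 2 * D) / (n : ℝ)
  have hsub : {X | ¬ TypicalSample μ k a b p Y q X} ⊆
      ((⋃ i ∈ (Finset.univ : Finset (Fin n)), {X | (k : ℝ) - 1 ≤ rankCount μ X i a}) ∪
        ⋃ i ∈ (Finset.univ : Finset (Fin n)), {X | b ≤ 1 ∧ (rankCount μ X i b : ℝ) ≤ k - 1}) ∪
        ⋃ y ∈ Y, {X | p ≤ μ.real (Metric.closedBall y (q y)) ∧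
          ∀ i, X i ∉ Metric.closedBall y (q y)} := by
    intro X hX
    by_contra hcon
    simp only [Set.mem_union, Set.mem_iUnion, not_or, not_exists] at hcon
    obtain ⟨⟨h1, h2⟩, h3⟩ := hcon
    refine hX ⟨fun i r hr => ?_, fun i r h0 hr => ?_, fun y hy hm => ?_⟩
    · by_contra hle
      have := le_rankCount_of_rk_lt hk hr (not_lt.1 hle)
      refine h1 i (Finset.mem_univ i) ?_
      have h' : (k : ℝ) ≤ rankCount μ X i a + 1 := by exact_mod_cast this
      simp only [Set.mem_ofPred_eq]
      linarith
    · by_contra hle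
      rw [not_le] at hle
      have := rankCount_lt_of_lt_rk h0 hr hle
      refine h2 i (Finset.mem_univ i) ⟨hle.le.trans measureReal_le_one, ?_⟩
      have h' : (rankCount μ X i b : ℝ) + 1 ≤ k := by exact_mod_cast this.le
      linarith
    · by_contra hno
      exact h3 y hy ⟨hm, not_exists.1 hno⟩
  have hε0 : 0 ≤ ε := (Real.exp_nonneg _).trans hε
  have B1 : ∀ i ∈ (Finset.univ : Finset (Fin n)),
      P {X | (k : ℝ) - 1 ≤ rankCount μ X i a} ≤ ENNReal.ofReal ε := fun i _ =>
    (rankCount_upper_tail hμ hD1 hDk i).trans (ENNReal.ofReal_le_ofReal hε)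
  have B2 : ∀ i ∈ (Finset.univ : Finset (Fin n)),
      P {X | b ≤ 1 ∧ (rankCount μ X i b : ℝ) ≤ k - 1} ≤ ENNReal.ofReal ε := by
    intro i _
    by_cases hb : b ≤ 1
    · simp only [hb, true_and]
      exact (rankCount_lower_tail hμ hD1 hDk hb i).trans (ENNReal.ofReal_le_ofReal hε)
    · simp [hb]
  have B3 : ∀ y ∈ Y, P {X | p ≤ μ.real (Metric.closedBall y (q y)) ∧
      ∀ i, X i ∉ Metric.closedBall y (q y)} ≤ ENNReal.ofReal ε := by
    intro y _
    by_cases hy : p ≤ μ.real (Metric.closedBall y (q y))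
    · simp only [hy, true_and]
      exact (measure_pi_forall_notMem_le μ measurableSet_closedBall hy).trans
        (ENNReal.ofReal_le_ofReal hp)
    · simp [hy]
  have U : ∀ {ι : Type} (s : Finset ι) (E : ι → Set (Fin n → Pt d)),
      (∀ i ∈ s, P (E i) ≤ ENNReal.ofReal ε) → P (⋃ i ∈ s, E i) ≤ s.card * ENNReal.ofReal ε := by
    intro ι s E h
    refine (measure_biUnion_finset_le s E).trans ((Finset.sum_le_sum h).trans (le_of_eq ?_))
    simp
  refine (measure_mono hsub).trans ((measure_union_le _ _).trans
    ((add_le_add (measure_union_le _ _) le_rfl).trans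
      ((add_le_add (add_le_add (U _ _ B1) (U _ _ B2)) (U _ _ B3)).trans (le_of_eq ?_))))
  rw [Finset.card_univ, Fintype.card_fin, ENNReal.ofReal_mul (by positivity),
    ENNReal.ofReal_add (by positivity) (by positivity), ENNReal.ofReal_mul (by positivity)]
  simp only [ENNReal.ofReal_natCast, ENNReal.ofReal_ofNat]
  ring

/-! ### Density estimates and connectivity for a typical sample -/

/-- The radius at which a ball around `a` has mass about `2⁻ᵈ k / (4 n)` if `f` is nearly constant
on it. -/
def hitRadius (f : Pt d → ℝ) (n k : ℕ) (a : Pt d) : ℝ :=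
  (k / (4 * n * unitVol d * f a)) ^ (d : ℝ)⁻¹ / 2

/-- `f` is resolved down to the level `lam` by `k` neighbours among `n` points and a net of mesh
`h`, with relative accuracy `κ`; here `S` bounds `f`. There are a level `η` and a radius `R` such
that the oscillation of `f` at scale `R` is small compared to `κ η`, balls of radius `R` at height
`η` are expected to contain far more than `k` sample points, and points at height `lam / 2` in
the same component of `{f > 0}` are connected at height `η`. The last condition makes the mesh
small compared to all radii of balls that are expected to contain `k` sample points. -/
structure Resolution (f : Pt d → ℝ) (S κ h : ℝ) (n k : ℕ) (lam η R : ℝ) : Prop where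
  η_pos : 0 < η
  η_le : η ≤ lam
  R_pos : 0 < R
  osc : ∀ x y, dist x y ≤ R → |f x - f y| ≤ κ * η / 64
  many : 16 * k < n * unitVol d * R ^ d * η
  connected : ∀ x y, lam / 2 ≤ f x → lam / 2 ≤ f y → y ∈ connectedComponentIn {z | 0 < f z} x →
    y ∈ connectedComponentIn (levelSet f η) x
  mesh_le : h ≤ R
  mesh : 2 * h ≤ ((16 / 9 : ℝ) ^ (d : ℝ)⁻¹ - 1) * (k / (4 * n * unitVol d * S)) ^ (d : ℝ)⁻¹

section Typical

variable {f : Pt d → ℝ} {n k : ℕ} {κ p : ℝ} {Y : Finset (Pt d)} {q : Pt d → ℝ} {X : Fin n → Pt d}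

theorem mass_le_of_typical {a b : ℝ}
    (hX : TypicalSample (law f) k a b p Y q X) (i : Fin n) {R u : ℝ} (hu : 0 ≤ u)
    (hR : rk X k (X i) < R) (h : ∀ z, dist z (X i) ≤ R → f z ≤ u) :
    a ≤ unitVol d * rk X k (X i) ^ d * u := by
  have hc : Continuous fun r : ℝ => unitVol d * r ^ d * u := by fun_prop
  refine ge_of_tendsto ((hc.tendsto (rk X k (X i))).mono_left
    (nhdsWithin_le_nhds (s := Set.Ioi (rk X k (X i))))) ?_
  filter_upwards [Ioo_mem_nhdsGT hR] with r hr
  have hr0 : 0 ≤ r := (rk_nonneg X k (X i)).trans hr.1.le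
  refine (hX.lower i r hr.1).le.trans ?_
  rw [← volume_real_closedBall (X i) hr0]
  exact law_real_le measurableSet_closedBall measure_closedBall_lt_top.ne hu fun z hz =>
    h z (le_trans hz hr.2.le)

theorem le_mass_of_typical (hf : ModalDensity f) {a b : ℝ}
    (hX : TypicalSample (law f) k a b p Y q X) (i : Fin n) {r l : ℝ} (hl : 0 ≤ l) (hr0 : 0 < r)
    (hr : r ≤ rk X k (X i)) (h : ∀ z, dist z (X i) ≤ r → l ≤ f z) :
    unitVol d * r ^ d * l ≤ b := by
  have hc : Continuous fun r : ℝ => unitVol d * r ^ d * l := by fun_prop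
  refine le_of_tendsto ((hc.tendsto r).mono_left (nhdsWithin_le_nhds (s := Set.Iio r))) ?_
  filter_upwards [Ioo_mem_nhdsLT hr0] with s hs
  rw [← volume_real_closedBall (X i) hs.1.le]
  refine le_trans ?_ (hX.upper i s hs.1.le (hs.2.trans_le hr))
  exact le_law_real hf measurableSet_closedBall hl fun z hz => h z (le_trans hz hs.2.le)

theorem rk_pos_of_typical (hf : ModalDensity f) (hd : 0 < d) {a b : ℝ} (ha : 0 < a)
    (hX : TypicalSample (law f) k a b p Y q X) (i : Fin n) : 0 < rk X k (X i) := by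
  obtain ⟨S, hS, hfS⟩ := hf.exists_bound
  refine lt_of_le_of_ne (rk_nonneg X k (X i)) fun h0 => ?_
  have := mass_le_of_typical hX i hS.le (lt_add_one _) fun z _ => hfS z
  rw [← h0, zero_pow hd.ne'] at this
  linarith

theorem fk_pos_of_typical (hf : ModalDensity f) (hd : 0 < d) (hk : 0 < k) (hκ' : κ ≤ 1 / 16)
    (hX : TypicalSample (law f) k ((k - 2 * (κ * k)) / n) ((k + 2 * (κ * k)) / n) p Y q X)
    (i : Fin n) : 0 < rk X k (X i) ∧ 0 < fk X k (X i) := by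
  have hk' : (0 : ℝ) < k := Nat.cast_pos.2 hk
  have hn : (0 : ℝ) < n := Nat.cast_pos.2 i.pos
  have hv := unitVol_pos d
  have ha : (0 : ℝ) < (k - 2 * (κ * k)) / n := div_pos (by nlinarith) hn
  have hr := rk_pos_of_typical hf hd ha hX i
  exact ⟨hr, by unfold fk; positivity⟩

/-- No density estimate at a sample point exceeds a bound for `f` by much. -/
theorem fk_lt_of_typical (hf : ModalDensity f) (hd : 0 < d) (hk : 0 < k) (hκ' : κ ≤ 1 / 16)
    (hX : TypicalSample (law f) k ((k - 2 * (κ * k)) / n) ((k + 2 * (κ * k)) / n) p Y q X)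
    {S : ℝ} (hS : 0 < S) (hfS : ∀ x, f x ≤ S) (i : Fin n) : fk X k (X i) < 2 * S := by
  have hk' : (0 : ℝ) < k := Nat.cast_pos.2 hk
  have hn : (0 : ℝ) < n := Nat.cast_pos.2 i.pos
  have hv := unitVol_pos d
  obtain ⟨hr, -⟩ := fk_pos_of_typical hf hd hk hκ' hX i
  have h1 := mass_le_of_typical hX i hS.le (lt_add_one _) fun z _ => hfS z
  rw [div_le_iff₀ hn] at h1
  rw [fk, div_lt_iff₀ (by positivity)]
  nlinarith

/-- The density estimate at a sample point, in terms of bounds for `f` on a larger ball. -/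
theorem fk_bounds_of_typical (hf : ModalDensity f) (hd : 0 < d) (hk : 0 < k) (hκ' : κ ≤ 1 / 16)
    (hX : TypicalSample (law f) k ((k - 2 * (κ * k)) / n) ((k + 2 * (κ * k)) / n) p Y q X)
    (hκ : 0 < κ) {i : Fin n} {R ω : ℝ} (hR : rk X k (X i) < R)
    (hω : ∀ z, dist z (X i) ≤ R → |f z - f (X i)| ≤ ω) :
    fk X k (X i) * (1 - 2 * κ) ≤ f (X i) + ω ∧ f (X i) - ω ≤ fk X k (X i) * (1 + 2 * κ) := by
  have hk' : (0 : ℝ) < k := Nat.cast_pos.2 hk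
  have hn : (0 : ℝ) < n := Nat.cast_pos.2 i.pos
  have hv := unitVol_pos d
  obtain ⟨hr, hfk⟩ := fk_pos_of_typical hf hd hk hκ' hX i
  have hω0 : 0 ≤ ω := (abs_nonneg _).trans (hω (X i) (by rw [dist_self]; linarith))
  have hV : 0 < unitVol d * rk X k (X i) ^ d := by positivity
  have hfkV : fk X k (X i) = k / n / (unitVol d * rk X k (X i) ^ d) := by
    rw [fk, div_div, mul_assoc]
  constructor
  · have h1 := mass_le_of_typical hX i (u := f (X i) + ω) (add_nonneg (hf.nonneg _) hω0) hR
      fun z hz => by linarith [(abs_le.1 (hω z hz)).2]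
    rw [hfkV, div_mul_eq_mul_div, div_le_iff₀ hV]
    refine le_trans (le_of_eq ?_) (h1.trans (le_of_eq ?_))
    · ring
    · ring
  · rcases le_or_gt (f (X i) - ω) 0 with h0 | h0
    · exact h0.trans (by positivity)
    have h1 := le_mass_of_typical hf hX i h0.le hr le_rfl
      fun z hz => by linarith [(abs_le.1 (hω z (hz.trans hR.le))).1]
    rw [hfkV, div_mul_eq_mul_div, le_div_iff₀ hV]
    refine le_trans (le_of_eq ?_) (h1.trans (le_of_eq ?_))
    · ring
    · ring

variable {S h lam η R : ℝ}

theorem rk_lt_of_le_fk (hk : 0 < k) (hR : Resolution f S κ h n k lam η R)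
    {i : Fin n} (hi : lam ≤ fk X k (X i)) : rk X k (X i) < R := by
  by_contra! hle
  have hk' : (0 : ℝ) < k := Nat.cast_pos.2 hk
  have hn : (0 : ℝ) < n := Nat.cast_pos.2 i.pos
  have hv := unitVol_pos d
  have hRpos := hR.R_pos
  have hη := hR.η_pos
  have h1 : R ^ d ≤ rk X k (X i) ^ d := pow_le_pow_left₀ hRpos.le hle d
  have h2 : η ≤ fk X k (X i) := hR.η_le.trans hi
  have h0 : 0 < rk X k (X i) ^ d := lt_of_lt_of_le (by positivity) h1
  rw [fk, le_div_iff₀ (by positivity)] at h2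
  have h3 : n * unitVol d * R ^ d * η ≤ η * (n * unitVol d * rk X k (X i) ^ d) := by
    rw [mul_comm]
    gcongr
  linarith [hR.many]

theorem rk_lt_of_le_f (hf : ModalDensity f) (hk : 0 < k)
    (hX : TypicalSample (law f) k ((k - 2 * (κ * k)) / n) ((k + 2 * (κ * k)) / n) p Y q X)
    (hκ' : κ ≤ 1 / 16) (hR : Resolution f S κ h n k lam η R)
    {i : Fin n} (hi : η / 4 ≤ f (X i)) : rk X k (X i) < R := by
  by_contra! hle
  have hk' : (0 : ℝ) < k := Nat.cast_pos.2 hk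
  have hn : (0 : ℝ) < n := Nat.cast_pos.2 i.pos
  have hv := unitVol_pos d
  have hRpos := hR.R_pos
  have hη := hR.η_pos
  have h1 := le_mass_of_typical hf hX i (l := η / 8) (by positivity) hRpos hle fun z hz => by
    have := (abs_le.1 (hR.osc z (X i) hz)).1
    nlinarith
  rw [le_div_iff₀ hn] at h1
  have := hR.many
  nlinarith

/-- Where the estimate is above the resolved level, it nearly equals the density. -/
theorem f_bounds_of_le_fk (hf : ModalDensity f) (hd : 0 < d) (hk : 0 < k) (hκ' : κ ≤ 1 / 16)
    (hX : TypicalSample (law f) k ((k - 2 * (κ * k)) / n) ((k + 2 * (κ * k)) / n) p Y q X)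
    (hκ : 0 < κ) (hR : Resolution f S κ h n k lam η R)
    {i : Fin n} (hi : lam ≤ fk X k (X i)) : fk X k (X i) * (1 - 3 * κ) ≤ f (X i) := by
  have hη := hR.η_pos
  have h1 := (fk_bounds_of_typical hf hd hk hκ' hX hκ (rk_lt_of_le_fk hk hR hi)
    fun z hz => hR.osc z (X i) hz).1
  have h2 : η ≤ fk X k (X i) := hR.η_le.trans hi
  nlinarith

/-- Where the density is not small, the estimate nearly equals it. -/
theorem fk_bounds_of_le_f (hf : ModalDensity f) (hd : 0 < d) (hk : 0 < k) (hκ' : κ ≤ 1 / 16)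
    (hX : TypicalSample (law f) k ((k - 2 * (κ * k)) / n) ((k + 2 * (κ * k)) / n) p Y q X)
    (hκ : 0 < κ) (hR : Resolution f S κ h n k lam η R)
    {i : Fin n} (hi : η / 4 ≤ f (X i)) :
    f (X i) * (1 - 3 * κ) ≤ fk X k (X i) ∧ fk X k (X i) ≤ 5 / 4 * f (X i) := by
  have hη := hR.η_pos
  obtain ⟨h1, h2⟩ := fk_bounds_of_typical hf hd hk hκ' hX hκ (rk_lt_of_le_f hf hk hX hκ' hR hi)
    fun z hz => hR.osc z (X i) hz
  have hω : κ * η / 64 ≤ κ * f (X i) / 16 := by nlinarith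
  have hfp : 0 < f (X i) := by linarith
  have hfk := (fk_pos_of_typical hf hd hk hκ' hX i).2
  constructor
  · have h3 : f (X i) * (1 - κ / 16) ≤ fk X k (X i) * (1 + 2 * κ) := by linarith
    have h4 : f (X i) * (1 - 3 * κ) * (1 + 2 * κ) ≤ f (X i) * (1 - κ / 16) := by
      rw [mul_assoc]
      exact mul_le_mul_of_nonneg_left (by nlinarith) hfp.le
    exact le_of_mul_le_mul_right (h4.trans h3) (by linarith)
  · have h3 : fk X k (X i) * (7 / 8) ≤ fk X k (X i) * (1 - 2 * κ) :=
      mul_le_mul_of_nonneg_left (by linarith) hfk.le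
    have h4 : κ * f (X i) ≤ 1 / 16 * f (X i) := mul_le_mul_of_nonneg_right hκ' hfp.le
    linarith

/-- Every point at height `η / 2` is close to a sample point, on the scale of the balls around it
that are expected to contain `k / 2` sample points. -/
theorem exists_near_sample (hf : ModalDensity f) (hd : 0 < d) (hk : 0 < k) (hn : 0 < n)
    (hκ' : κ ≤ 1 / 16) (hfS : ∀ x, f x ≤ S)
    {a b : ℝ} (hX : TypicalSample (law f) k a b (k / (8 * 2 ^ d * n)) Y (hitRadius f n k) X)
    (hR : Resolution f S κ h n k lam η R)
    (hY : ∀ x ∈ tsupport f, ∃ y ∈ Y, dist x y ≤ h) {y : Pt d} (hy : η / 2 ≤ f y) :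
    ∃ i, 2 * n * unitVol d * f y * (2 * dist y (X i)) ^ d ≤ k := by
  have hk' : (0 : ℝ) < k := Nat.cast_pos.2 hk
  have hn' : (0 : ℝ) < n := Nat.cast_pos.2 hn
  have hv := unitVol_pos d
  have hη := hR.η_pos
  have hRp := hR.R_pos
  have hy0 : 0 < f y := by linarith
  obtain ⟨a, haY, hya⟩ := hY y (subset_tsupport f hy0.ne')
  have hω : κ * η / 64 ≤ f y / 512 := by nlinarith
  have hosc := abs_le.1 (hR.osc y a (hya.trans hR.mesh_le))
  have hfa : 0 < f a := by linarith
  have hfaη : η / 4 ≤ f a := by linarith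
  set A : ℝ := k / (4 * n * unitVol d * f a) with hA
  have hA0 : 0 < A := by positivity
  have hApow : (A ^ (d : ℝ)⁻¹) ^ d = A := Real.rpow_inv_natCast_pow hA0.le hd.ne'
  have hq : hitRadius f n k a = A ^ (d : ℝ)⁻¹ / 2 := rfl
  have hq0 : 0 ≤ hitRadius f n k a := by rw [hq]; positivity
  have hAv : A * (4 * n * unitVol d * f a) = k := by rw [hA]; field_simp
  have hqR : hitRadius f n k a ≤ R := by
    refine le_of_lt (lt_of_pow_lt_pow_left₀ d hRp.le ?_)
    rw [hq, div_pow, hApow]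
    refine lt_of_le_of_lt (div_le_self hA0.le (one_le_pow₀ (by norm_num))) ?_
    rw [hA, div_lt_iff₀ (by positivity)]
    have h1 : n * unitVol d * R ^ d * η ≤ n * unitVol d * R ^ d * (4 * f a) := by
      gcongr
      linarith
    have := hR.many
    nlinarith
  have hmass : k / (8 * 2 ^ d * n) ≤
      (law f).real (Metric.closedBall a (hitRadius f n k a)) := by
    have h1 := le_law_real hf (s := Metric.closedBall a (hitRadius f n k a)) measurableSet_closedBall
      (b := f a / 2) (by positivity) fun z hz => by
        have := (abs_le.1 (hR.osc z a (le_trans hz hqR))).1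
        linarith
    refine le_trans (le_of_eq ?_) h1
    rw [volume_real_closedBall a hq0, hq, div_pow, hApow, hA]
    field_simp
    ring
  obtain ⟨i, hi⟩ := hX.hits a haY hmass
  refine ⟨i, ?_⟩
  have hdist : dist y (X i) ≤ h + hitRadius f n k a := by
    refine (dist_triangle y a (X i)).trans (add_le_add hya ?_)
    rw [dist_comm]; exact hi
  have h1 : 2 * dist y (X i) ≤ (16 / 9 : ℝ) ^ (d : ℝ)⁻¹ * A ^ (d : ℝ)⁻¹ := by
    have h2 : (k / (4 * n * unitVol d * S)) ^ (d : ℝ)⁻¹ ≤ A ^ (d : ℝ)⁻¹ := by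
      have hS : 0 < S := hfa.trans_le (hfS a)
      refine Real.rpow_le_rpow (by positivity) ?_ (by positivity)
      rw [hA]
      gcongr
      exact hfS a
    have h3 : (1 : ℝ) ≤ (16 / 9 : ℝ) ^ (d : ℝ)⁻¹ := Real.one_le_rpow (by norm_num) (by positivity)
    have h4 := hR.mesh.trans (mul_le_mul_of_nonneg_left h2 (sub_nonneg.2 h3))
    rw [hq] at hdist
    linarith
  have h2 : (2 * dist y (X i)) ^ d ≤ 16 / 9 * A := by
    refine (pow_le_pow_left₀ (by positivity) h1 d).trans (le_of_eq ?_)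
    rw [mul_pow, hApow, Real.rpow_inv_natCast_pow (by norm_num) hd.ne']
  have h3 : f y ≤ 9 / 8 * f a := by linarith
  calc 2 * n * unitVol d * f y * (2 * dist y (X i)) ^ d
      ≤ 2 * n * unitVol d * (9 / 8 * f a) * (16 / 9 * A) := by gcongr
    _ = A * (4 * n * unitVol d * f a) := by ring
    _ = k := hAv

/-- Sample points in a connected set at height `η / 2` are connected in a `k`-NN graph which has
all sample points near that set as vertices. The set is covered by closed sets, one around each
sample point, and sample points whose sets meet are adjacent. -/
theorem reachable_of_preconnected (hf : ModalDensity f) (hd : 0 < d) (hk : 0 < k)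
    (hκ' : κ ≤ 1 / 16) (hκ : 0 < κ) (hfS : ∀ x, f x ≤ S)
    (hX : TypicalSample (law f) k ((k - 2 * (κ * k)) / n) ((k + 2 * (κ * k)) / n)
      (k / (8 * 2 ^ d * n)) Y (hitRadius f n k) X)
    (hR : Resolution f S κ h n k lam η R)
    (hY : ∀ x ∈ tsupport f, ∃ y ∈ Y, dist x y ≤ h) {U : Set (Pt d)} (hU : IsPreconnected U)
    (hUη : ∀ y ∈ U, η / 2 ≤ f y) {τ : ℝ}
    (hτ : ∀ i, ∀ y ∈ U, dist y (X i) ≤ R → τ ≤ fk X k (X i)) {i j : Fin n} (hi : X i ∈ U)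
    (hj : X j ∈ U) : (knnGraph X k τ).Reachable i j := by
  have hk' : (0 : ℝ) < k := Nat.cast_pos.2 hk
  have hn : 0 < n := i.pos
  have hn' : (0 : ℝ) < n := Nat.cast_pos.2 hn
  have hv := unitVol_pos d
  have hη := hR.η_pos
  have hRp := hR.R_pos
  set D : Fin n → Set (Pt d) :=
    fun i => {y | 2 * n * unitVol d * f y * (2 * dist y (X i)) ^ d ≤ k} with hD
  have hDclosed : ∀ i, IsClosed (D i) := fun i => by
    have := hf.continuous
    exact isClosed_le (by fun_prop) continuous_const
  have hDR : ∀ i, ∀ y ∈ U, y ∈ D i → dist y (X i) ≤ R := by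
    intro i y hyU hy
    by_contra! hlt
    have hy' : 2 * n * unitVol d * f y * (2 * dist y (X i)) ^ d ≤ k := hy
    have h1 : R ^ d ≤ (2 * dist y (X i)) ^ d := pow_le_pow_left₀ hRp.le (by linarith) d
    have h2 : n * unitVol d * R ^ d * η ≤ 2 * n * unitVol d * f y * (2 * dist y (X i)) ^ d := by
      calc n * unitVol d * R ^ d * η = 2 * n * unitVol d * (η / 2) * R ^ d := by ring
        _ ≤ 2 * n * unitVol d * f y * (2 * dist y (X i)) ^ d := by
          have hyη := hUη y hyU
          have hy0 : 0 ≤ f y := hf.nonneg y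
          gcongr
    linarith [hR.many]
  have hself : ∀ i, X i ∈ D i := fun i => by
    simp only [hD, Set.mem_ofPred_eq, dist_self, mul_zero, zero_pow hd.ne']
    exact hk'.le
  -- the radius of the closed sets is at most half of the nearest-neighbour radius
  have hrk : ∀ i, ∀ y ∈ U, y ∈ D i → ∀ r, 2 * n * unitVol d * f y * (2 * r) ^ d ≤ k →
      2 * r ≤ rk X k (X i) := by
    intro i y hyU hy r hr
    have hyη := hUη y hyU
    have hosc := abs_le.1 (hR.osc y (X i) (hDR i y hyU hy))
    have hω : κ * η / 64 ≤ f y / 512 := by nlinarith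
    have hfk := (fk_bounds_of_le_f hf hd hk hκ' hX hκ hR (i := i) (by linarith)).2
    obtain ⟨hr0, hfk0⟩ := fk_pos_of_typical hf hd hk hκ' hX i
    have hfk2 : fk X k (X i) ≤ 2 * f y := by linarith
    refine le_of_pow_le_pow_left₀ hd.ne' hr0.le ?_
    rw [fk, div_le_iff₀ (by positivity)] at hfk2
    have hy0 : 0 < f y := by linarith
    have h3 : 2 * n * unitVol d * f y * (2 * r) ^ d ≤
        2 * n * unitVol d * f y * rk X k (X i) ^ d := hr.trans (hfk2.trans (le_of_eq (by ring)))
    exact le_of_mul_le_mul_left h3 (by positivity)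
  refine rel_of_finite_closed_cover hU hDclosed ?_
    (r := fun i j => (knnGraph X k τ).Reachable i j)
    ⟨fun a => SimpleGraph.Reachable.refl a, fun h => h.symm, fun h h' => h.trans h'⟩ ?_
    hi (hself i) hj (hself j)
  · intro y hy
    obtain ⟨i, hi⟩ := exists_near_sample hf hd hk hn hκ' hfS hX hR hY (hUη y hy)
    exact Set.mem_iUnion.2 ⟨i, hi⟩
  · intro a b y hyU hya hyb
    by_cases hab : a = b
    · rw [hab]
    refine SimpleGraph.Adj.reachable ⟨hab, hτ a y hyU (hDR a y hyU hya),
      hτ b y hyU (hDR b y hyU hyb), ?_⟩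
    have h1 : ∀ c, y ∈ D c → 2 * max (dist y (X a)) (dist y (X b)) ≤ rk X k (X c) := by
      intro c hc
      rcases max_cases (dist y (X a)) (dist y (X b)) with ⟨h, -⟩ | ⟨h, -⟩ <;> rw [h]
      · exact hrk c y hyU hc _ hya
      · exact hrk c y hyU hc _ hyb
    have h2 : ‖X a - X b‖ ≤ 2 * max (dist y (X a)) (dist y (X b)) := by
      rw [← dist_eq_norm]
      have h3 := dist_triangle_left (X a) (X b) y
      have h4 := le_max_left (dist y (X a)) (dist y (X b))
      have h5 := le_max_right (dist y (X a)) (dist y (X b))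
      linarith
    exact le_min (h2.trans (h1 a hya)) (h2.trans (h1 b hyb))

end Typical

/-! ### Injectivity for a typical sample -/

section Matching

variable {f : Pt d → ℝ} {n k : ℕ} {κ S h lam η R δ ε₀ εt : ℝ} {Y : Finset (Pt d)}
  {X : Fin n → Pt d}

theorem le_of_mem_component {f : Pt d → ℝ} {t : ℝ} {x y : Pt d}
    (h : y ∈ connectedComponentIn (levelSet f t) x) : t ≤ f y :=
  connectedComponentIn_subset (levelSet f t) x h

/-- `M` is a match for the point `x`, considered at the graph level `τ`: it lies in the component of
`{f > 0}` around `x` if `τ` is low, and in the component of `{f ≥ f x - ε₀}` otherwise. -/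
def IsMatch (f : Pt d → ℝ) (ε₀ η τ : ℝ) (x : Pt d) (M : Set (Pt d)) : Prop :=
  (τ ≤ η / 2 → M ⊆ connectedComponentIn {z | 0 < f z} x) ∧
    (η / 2 < τ → M ⊆ connectedComponentIn (levelSet f (f x - ε₀)) x)

/-- Sample points with a common match are connected in the graph formed at the lower one of their
levels. If this graph is low, they are connected in `{f ≥ η}`; otherwise the components of level
sets in the definition of `IsMatch` connect them. -/
theorem reachable_of_isMatch (hf : ModalDensity f) (hd : 0 < d) (hk : 0 < k)
    (hκ' : κ ≤ 1 / 16) (hκ : 0 < κ) (hfS : ∀ x, f x ≤ S)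
    (hX : TypicalSample (law f) k ((k - 2 * (κ * k)) / n) ((k + 2 * (κ * k)) / n)
      (k / (8 * 2 ^ d * n)) Y (hitRadius f n k) X)
    (hR : Resolution f S κ h n k lam η R)
    (hY : ∀ x ∈ tsupport f, ∃ y ∈ Y, dist x y ≤ h) (hβ : beta d δ n k = 4 * κ)
    (hε₀ : 0 ≤ ε₀) (hεt : 0 ≤ εt) {i j : Fin n} (hi : lam ≤ fk X k (X i))
    (hij : fk X k (X i) ≤ fk X k (X j)) {M : Set (Pt d)} (hM : M.Nonempty)
    (hMi : IsMatch f ε₀ η (fk X k (X i) - 9 * beta d δ n k * fk X k (X i) - ε₀ - εt) (X i) M)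
    (hMj : IsMatch f ε₀ η (fk X k (X j) - 9 * beta d δ n k * fk X k (X j) - ε₀ - εt) (X j) M) :
    (knnGraph X k (fk X k (X i) - 9 * beta d δ n k * fk X k (X i) - ε₀ - εt)).Reachable i j := by
  obtain ⟨m, hm⟩ := hM
  rw [hβ] at hMi hMj ⊢
  set a := fk X k (X i) with ha
  set b := fk X k (X j) with hb
  have hη := hR.η_pos
  have hηa : η ≤ a := hR.η_le.trans hi
  have hfi := f_bounds_of_le_fk hf hd hk hκ' hX hκ hR hi
  have hfj := f_bounds_of_le_fk hf hd hk hκ' hX hκ hR (hi.trans hij)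
  rw [← ha] at hfi
  rw [← hb] at hfj
  set τ := a - 9 * (4 * κ) * a - ε₀ - εt with hτ
  rcases le_or_gt τ (η / 2) with hlow | hhigh
  · have hmi := hMi.1 hlow hm
    have hmj : m ∈ connectedComponentIn {z | 0 < f z} (X j) := by
      rcases le_or_gt (b - 9 * (4 * κ) * b - ε₀ - εt) (η / 2) with h' | h'
      · exact hMj.1 h' hm
      · refine connectedComponentIn_mono _ ?_ (hMj.2 h' hm)
        intro z hz
        have hz' : f (X j) - ε₀ ≤ f z := hz
        have : 0 < f z := by nlinarith
        exact this
    have hconn := hR.connected (X i) (X j) (by nlinarith) (by nlinarith)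
      (connectedComponentIn_trans hmi (connectedComponentIn_symm hmj))
    have hXi : X i ∈ connectedComponentIn (levelSet f η) (X i) :=
      mem_connectedComponentIn (connectedComponentIn_nonempty_iff.1 ⟨_, hconn⟩)
    refine reachable_of_preconnected hf hd hk hκ' hκ hfS hX hR hY
      (isPreconnected_connectedComponentIn (F := levelSet f η) (x := X i)) ?_ ?_ hXi hconn
    · intro y hy
      have : η ≤ f y := le_of_mem_component hy
      linarith
    · intro l y hy hyl
      have hy' : η ≤ f y := le_of_mem_component hy
      have hosc := abs_le.1 (hR.osc y (X l) hyl)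
      have hω : κ * η ≤ 1 / 16 * η := mul_le_mul_of_nonneg_right hκ' hη.le
      have h1 := (fk_bounds_of_le_f hf hd hk hκ' hX hκ hR (i := l) (by linarith)).1
      nlinarith
  · have hab : τ ≤ b - 9 * (4 * κ) * b - ε₀ - εt := by
      have h1 : 0 < 1 - 9 * (4 * κ) := by
        by_contra! h0
        nlinarith
      rw [hτ]
      nlinarith
    have hmi := hMi.2 hhigh hm
    have hmj := hMj.2 (hhigh.trans_le hab) hm
    set Ui := connectedComponentIn (levelSet f (f (X i) - ε₀)) (X i) with hUi
    set Uj := connectedComponentIn (levelSet f (f (X j) - ε₀)) (X j) with hUj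
    have hXi : X i ∈ Ui := mem_connectedComponentIn (connectedComponentIn_nonempty_iff.1 ⟨_, hmi⟩)
    have hXj : X j ∈ Uj := mem_connectedComponentIn (connectedComponentIn_nonempty_iff.1 ⟨_, hmj⟩)
    have hU : IsPreconnected (Ui ∪ Uj) :=
      isPreconnected_connectedComponentIn.union m hmi hmj isPreconnected_connectedComponentIn
    have hlev : ∀ y ∈ Ui ∪ Uj, a * (1 - 3 * κ) - ε₀ ≤ f y := by
      rintro y (hy | hy)
      · have hy' : f (X i) - ε₀ ≤ f y := le_of_mem_component hy
        linarith
      · have hy' : f (X j) - ε₀ ≤ f y := le_of_mem_component hy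
        nlinarith
    have hκa : 0 < κ * a := mul_pos hκ (hη.trans_le hηa)
    refine reachable_of_preconnected hf hd hk hκ' hκ hfS hX hR hY hU ?_ ?_ (Or.inl hXi)
      (Or.inr hXj)
    · intro y hy
      have := hlev y hy
      nlinarith
    · intro l y hy hyl
      have hy' := hlev y hy
      have hosc := abs_le.1 (hR.osc y (X l) hyl)
      have hω : κ * η ≤ 1 / 16 * η := mul_le_mul_of_nonneg_right hκ' hη.le
      have hω' : κ * η ≤ κ * a := mul_le_mul_of_nonneg_left hηa hκ.le
      have h1 := (fk_bounds_of_le_f hf hd hk hκ' hX hκ hR (i := l) (by nlinarith)).1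
      have h2 : (a * (1 - 3 * κ) - ε₀ - κ * a / 64) * (1 - 3 * κ) ≤ f (X l) * (1 - 3 * κ) :=
        mul_le_mul_of_nonneg_right (by linarith) (by linarith)
      refine le_trans ?_ (h2.trans h1)
      nlinarith [mul_nonneg hκ.le hκa.le, mul_nonneg hκ.le hε₀]

/-- The sample points that give rise to estimates have matches among the targets. -/
theorem exists_isMatch (hf : ModalDensity f) (hε₀ : EpsDensity f ε₀) (hd : 0 < d) (hk : 0 < k)
    (hκ' : κ ≤ 1 / 16) (hκ : 0 < κ) {p : ℝ} {q : Pt d → ℝ}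
    (hX : TypicalSample (law f) k ((k - 2 * (κ * k)) / n) ((k + 2 * (κ * k)) / n) p Y q X)
    (hR : Resolution f S κ h n k lam η R) (hβ : beta d δ n k = 4 * κ) (hεt : 0 ≤ εt) {i : Fin n}
    (hi : lam ≤ fk X k (X i)) :
    ∃ M ∈ targets f δ ε₀ X k (fk X k (X i)),
      IsMatch f ε₀ η (fk X k (X i) - 9 * beta d δ n k * fk X k (X i) - ε₀ - εt) (X i) M := by
  have hη := hR.η_pos
  have hηa : η ≤ fk X k (X i) := hR.η_le.trans hi
  have hfi := f_bounds_of_le_fk hf hd hk hκ' hX hκ hR hi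
  have htarget : ∀ M, IsEpsModalSet f ε₀ M → f (X i) ≤ height f M →
      M ∈ targets f δ ε₀ X k (fk X k (X i)) := fun M hM hle =>
    ⟨hM, i, by rw [hβ]; nlinarith, hle⟩
  rcases le_or_gt (fk X k (X i) - 9 * beta d δ n k * fk X k (X i) - ε₀ - εt) (η / 2) with h1 | h1
  · obtain ⟨M, hM, hle, hsub⟩ := exists_isEpsModalSet_subset_pos hf hε₀ (x := X i) (by nlinarith)
    exact ⟨M, htarget M hM hle, fun _ => hsub, fun h2 => absurd h2 (not_lt.2 h1)⟩
  · have h2 : ε₀ < f (X i) := by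
      rw [hβ] at h1
      nlinarith
    obtain ⟨M, hM, hle, hsub⟩ := exists_isEpsModalSet_subset hf hε₀.nonneg h2
    exact ⟨M, htarget M hM hle, fun h3 => absurd h1 (not_lt.2 h3), fun _ => hsub⟩

/-- For a typical sample, the estimates chosen above a resolved level are injectively matched to
targets. -/
theorem exists_injOn_of_resolution (hf : ModalDensity f) (hε₀ : EpsDensity f ε₀) (hd : 0 < d)
    (hk : 0 < k) (hκ' : κ ≤ 1 / 16) (hκ : 0 < κ) (hfS : ∀ x, f x ≤ S)
    (hX : TypicalSample (law f) k ((k - 2 * (κ * k)) / n) ((k + 2 * (κ * k)) / n)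
      (k / (8 * 2 ^ d * n)) Y (hitRadius f n k) X)
    (hR : Resolution f S κ h n k lam η R)
    (hY : ∀ x ∈ tsupport f, ∃ y ∈ Y, dist x y ≤ h) (hβ : beta d δ n k = 4 * κ)
    (hεt : 0 ≤ εt) {σ : Equiv.Perm (Fin n)} (hσ : IsSorting X k σ) {t : ℝ} (ht : lam ≤ t) :
    ∃ Φ : ℝ × Set (Fin n) → Set (Pt d),
      Set.InjOn Φ {e | e ∈ estimates δ ε₀ εt X k σ ∧ t ≤ e.1} ∧
      ∀ e ∈ estimates δ ε₀ εt X k σ, t ≤ e.1 → Φ e ∈ targets f δ ε₀ X k e.1 := by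
  have key : ∀ e : ℝ × Set (Fin n), e ∈ estimates δ ε₀ εt X k σ ∧ t ≤ e.1 →
      ∃ M ∈ targets f δ ε₀ X k e.1, ∃ i ∈ e.2, fk X k (X i) = e.1 ∧
        IsMatch f ε₀ η (e.1 - 9 * beta d δ n k * e.1 - ε₀ - εt) (X i) M := by
    rintro e ⟨he, hte⟩
    obtain ⟨i, hie, hi⟩ := exists_mem_of_mem_estimates he
    have hi := hi (by
      have h1 := (fk_pos_of_typical hf hd hk hκ' hX i).2
      have h2 := hε₀.nonneg
      rw [hβ, ← hie]
      positivity)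
    obtain ⟨M, hM, hmatch⟩ := exists_isMatch hf hε₀ hd hk hκ' hκ hX hR hβ hεt (i := i)
      (by rw [hie]; exact ht.trans hte)
    rw [hie] at hM hmatch
    exact ⟨M, hM, i, hi, hie, hmatch⟩
  choose! Φ hΦ hI using key
  refine ⟨Φ, ?_, fun e he hte => hΦ e ⟨he, hte⟩⟩
  have sep : ∀ e e' : ℝ × Set (Fin n), e ∈ estimates δ ε₀ εt X k σ ∧ t ≤ e.1 →
      e' ∈ estimates δ ε₀ εt X k σ ∧ t ≤ e'.1 → Φ e = Φ e' → e.1 ≤ e'.1 →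
      ∃ i ∈ e.2, ∃ j ∈ e'.2,
        (knnGraph X k (e.1 - 9 * beta d δ n k * e.1 - ε₀ - εt)).Reachable i j := by
    intro e e' he he' hee' hle
    obtain ⟨i, hi, hie, h1⟩ := hI e he
    obtain ⟨j, hj, hje, h2⟩ := hI e' he'
    refine ⟨i, hi, j, hj, ?_⟩
    rw [← hee', ← hje] at h2
    rw [← hie] at h1 ⊢
    exact reachable_of_isMatch hf hd hk hκ' hκ hfS hX hR hY hβ hε₀.nonneg hεt
      (by rw [hie]; exact ht.trans he.2) (by rw [hie, hje]; exact hle) (hΦ e he).1.nonempty h1 h2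
  intro e he e' he' hee'
  by_contra hne
  rcases not_reachable_of_ne hσ he.1 he'.1 hne with ⟨hle, h⟩ | ⟨hle, h⟩
  · obtain ⟨i, hi, j, hj, hij⟩ := sep e e' he he' hee' hle
    exact h i hi j hj hij
  · obtain ⟨i, hi, j, hj, hij⟩ := sep e' e he' he hee'.symm hle
    exact h i hi j hj hij

end Matching

/-! ### Consequences of admissibility -/

theorem Cdn_nonneg (d : ℕ) {δ : ℝ} (hδ₀ : 0 < δ) (hδ₁ : δ < 1) (n : ℕ) : 0 ≤ Cdn d δ n := by
  have : 0 ≤ Real.log (2 / δ) := Real.log_nonneg (by rw [le_div_iff₀ hδ₀]; linarith)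
  unfold Cdn
  positivity

/-- Admissibility forces `C_{δ,n}` to be positive and bounds `k` from below. -/
theorem Admissible.pos_and_le {f : Pt d → ℝ} {δ ε₀ εt rs : ℝ} {n k : ℕ} {M : Set (Pt d)}
    (h : Admissible f δ ε₀ εt rs n k M) (hd : 0 < d) (hδ₀ : 0 < δ) (hδ₁ : δ < 1) (hk : 1 ≤ k) :
    0 < Cdn d δ n ∧ (2 : ℝ) ^ (7 + d) * Cdn d δ n ^ 2 ≤ k := by
  obtain ⟨lam, rM, A, S, M₀, l, u, hgeo, -, hmax, s, hs, hus, hks⟩ := h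
  refine ⟨lt_of_le_of_ne (Cdn_nonneg d hδ₀ hδ₁ n) fun h0 => ?_, (le_max_right _ _).trans hmax⟩
  -- otherwise `s = u⁻¹ 0 = 0`, and the upper bound for `k` vanishes
  rw [← h0, zero_mul, zero_div, ← hgeo.u_zero] at hus
  have hs0 : s = 0 := hgeo.u_mono.injOn hs ⟨le_rfl, hgeo.rM_pos.le⟩ hus
  rw [hs0, zero_pow hd.ne', mul_zero, zero_mul] at hks
  have : (1 : ℝ) ≤ k := by exact_mod_cast hk
  linarith

/-- The failure probability of a typical sample is at most `δ`. -/
theorem failure_bound {d n k : ℕ} (hd : 0 < d) {δ : ℝ} (hδ₀ : 0 < δ) (hδ₁ : δ < 1)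
    (hC : 0 < Cdn d δ n) (hk : (2 : ℝ) ^ (7 + d) * Cdn d δ n ^ 2 ≤ k) (hn : 0 < n)
    {κ : ℝ} (hκ : κ = Cdn d δ n / √(k : ℝ)) :
    0 < κ ∧ κ ≤ 1 / 16 ∧ 1 ≤ κ * k ∧ Real.exp (-((κ * k) ^ 2 / k) / 4) ≤
      Real.exp (-(Cdn d δ n ^ 2 / 4)) ∧
    Real.exp (-(n * (k / (8 * 2 ^ d * n)))) ≤ Real.exp (-(Cdn d δ n ^ 2 / 4)) ∧
    (2 * n + (n : ℝ) ^ (2 * d)) * Real.exp (-(Cdn d δ n ^ 2 / 4)) ≤ δ := by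
  set C := Cdn d δ n with hCdef
  have hn' : (0 : ℝ) < n := Nat.cast_pos.2 hn
  have hk0 : (0 : ℝ) < k := lt_of_lt_of_le (by positivity) hk
  have hsq : √(k : ℝ) ^ 2 = k := Real.sq_sqrt hk0.le
  have hs0 : 0 < √(k : ℝ) := Real.sqrt_pos.2 hk0
  have hκ0 : 0 < κ := by rw [hκ]; positivity
  have hκs : κ * √(k : ℝ) = C := by rw [hκ]; field_simp
  have hκC : κ ^ 2 * k = C ^ 2 := by rw [← hκs, mul_pow, hsq]
  have h2d : (2 : ℝ) ≤ 2 ^ d := by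
    calc (2 : ℝ) = 2 ^ 1 := (pow_one 2).symm
      _ ≤ 2 ^ d := pow_le_pow_right₀ (by norm_num) hd
  have hC2 : 0 < C ^ 2 := by positivity
  have hk256 : 256 * C ^ 2 ≤ k := by
    refine le_trans ?_ hk
    rw [pow_add]
    nlinarith
  have hκ16 : κ ≤ 1 / 16 := by
    refine le_of_pow_le_pow_left₀ two_ne_zero (by norm_num) ?_
    have : 256 * κ ^ 2 * k ≤ 1 * k := by linarith
    have := le_of_mul_le_mul_right this hk0
    linarith
  -- lower bounds for the logarithms in `C`
  have hL : 0.69 ≤ Real.log (2 / δ) := by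
    have h1 : Real.log 2 ≤ Real.log (2 / δ) :=
      Real.log_le_log (by norm_num) (by rw [le_div_iff₀ hδ₀]; linarith)
    linarith [Real.log_two_gt_d9]
  have hn2 : 2 ≤ n := by
    by_contra! hlt
    have : n = 1 := by omega
    rw [hCdef, Cdn, this] at hC
    simp at hC
  have hln : 0.69 ≤ Real.log n := by
    have h1 : Real.log 2 ≤ Real.log n := Real.log_le_log (by norm_num) (by exact_mod_cast hn2)
    linarith [Real.log_two_gt_d9]
  set L := Real.log (2 / δ)
  set w : ℝ := d * Real.log n with hw
  have hd1 : (1 : ℝ) ≤ d := by exact_mod_cast hd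
  have hw1 : 0.69 ≤ w := by rw [hw]; nlinarith
  have hCw : C ^ 2 = 256 * L ^ 2 * w := by
    rw [hCdef, Cdn, mul_pow, Real.sq_sqrt (by linarith)]
    ring
  have hLw1 : 0.69 * w ≤ L * w := mul_le_mul_of_nonneg_right hL (by linarith)
  have hLw2 : L * 0.69 ≤ L * w := mul_le_mul_of_nonneg_left hw1 (by linarith)
  have hLLw : 0.69 * (L * w) ≤ L * (L * w) := mul_le_mul_of_nonneg_right hL (by nlinarith)
  have hmain : 2 * w + L + 1 ≤ C ^ 2 / 4 := by
    rw [hCw]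
    nlinarith
  refine ⟨hκ0, hκ16, ?_, ?_, ?_, ?_⟩
  · have : C ^ 2 * 16 ≤ κ * k := by
      rw [← hκC]
      have : κ * (κ * k) ≤ 1 / 16 * (κ * k) := mul_le_mul_of_nonneg_right hκ16 (by positivity)
      nlinarith
    linarith
  · refine Real.exp_le_exp.2 (le_of_eq ?_)
    have : (κ * k) ^ 2 / k = C ^ 2 := by rw [← hκC]; field_simp
    rw [this]; ring
  · refine Real.exp_le_exp.2 (neg_le_neg ?_)
    have h1 : n * (k / (8 * 2 ^ d * n)) = (k : ℝ) / (8 * 2 ^ d) := by field_simp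
    rw [h1, le_div_iff₀ (by positivity)]
    refine le_trans ?_ hk
    rw [pow_add]
    have : 0 < (2 : ℝ) ^ d * C ^ 2 := by positivity
    nlinarith
  · have h1 : Real.exp (-(C ^ 2 / 4)) ≤ Real.exp (-(2 * w)) * Real.exp (-L) * Real.exp (-1) := by
      rw [← Real.exp_add, ← Real.exp_add]
      exact Real.exp_le_exp.2 (by linarith)
    have h2 : Real.exp (-(2 * w)) = ((n : ℝ) ^ (2 * d))⁻¹ := by
      rw [Real.exp_neg, hw, ← mul_assoc]
      congr 1
      rw [show (2 : ℝ) * d = ((2 * d : ℕ) : ℝ) by push_cast; ring, Real.exp_nat_mul,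
        Real.exp_log hn']
    have h3 : Real.exp (-L) = δ / 2 := by
      rw [Real.exp_neg, Real.exp_log (by positivity), inv_div]
    have h4 : (n : ℝ) ≤ (n : ℝ) ^ (2 * d) :=
      le_self_pow₀ (by exact_mod_cast hn) (by omega)
    have h5 : Real.exp (-1) ≤ 1 / 2 := by
      rw [Real.exp_neg, inv_le_comm₀ (Real.exp_pos 1) (by norm_num)]
      linarith [Real.exp_one_gt_d9]
    have hN : 0 < (n : ℝ) ^ (2 * d) := by positivity
    calc (2 * n + (n : ℝ) ^ (2 * d)) * Real.exp (-(C ^ 2 / 4))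
        ≤ (3 * (n : ℝ) ^ (2 * d)) *
          (((n : ℝ) ^ (2 * d))⁻¹ * (δ / 2) * Real.exp (-1)) := by
          rw [h2, h3] at h1
          gcongr
          linarith
      _ = 3 * (δ / 2) * Real.exp (-1) := by field_simp
      _ ≤ δ := by nlinarith

/-! ### Nets -/

theorem exists_grid_near {ρ : ℝ} (hρ : 0 < ρ) {m : ℕ} (hm : 0 < m) {x : ℝ} (hx : |x| ≤ ρ) :
    ∃ j : Fin m, |x - (-ρ + 2 * ρ * j / m)| ≤ 2 * ρ / m := by
  have hm' : (0 : ℝ) < m := Nat.cast_pos.2 hm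
  obtain ⟨hx1, hx2⟩ := abs_le.1 hx
  set s : ℝ := (x + ρ) * m / (2 * ρ) with hs
  have hs0 : 0 ≤ s := by
    have : 0 ≤ x + ρ := by linarith
    positivity
  have hsm : s ≤ m := by
    rw [hs, div_le_iff₀ (by positivity)]
    nlinarith
  have hxs : x = -ρ + 2 * ρ * s / m := by rw [hs]; field_simp; ring
  obtain ⟨j, hj⟩ : ∃ j : Fin m, |s - j| ≤ 1 := by
    have h1 := Nat.floor_le hs0
    have h2 := Nat.lt_floor_add_one s
    rcases lt_or_ge ⌊s⌋₊ m with h | h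
    · exact ⟨⟨⌊s⌋₊, h⟩, by rw [abs_le]; constructor <;> simp only <;> linarith⟩
    · refine ⟨⟨m - 1, by omega⟩, ?_⟩
      have h3 : ((m - 1 : ℕ) : ℝ) = m - 1 := by rw [Nat.cast_sub hm]; simp
      have h4 : (m : ℝ) ≤ ⌊s⌋₊ := by exact_mod_cast h
      rw [abs_le]
      simp only [h3]
      constructor <;> linarith
  refine ⟨j, ?_⟩
  rw [hxs, show -ρ + 2 * ρ * s / m - (-ρ + 2 * ρ * j / m) = 2 * ρ / m * (s - j) by ring, abs_mul,
    abs_of_pos (by positivity : 0 < 2 * ρ / m)]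
  exact mul_le_of_le_one_right (by positivity) hj

/-- A compact set has nets of cardinality `n ^ (2 d)` and mesh of order `1 / n²`. -/
theorem exists_nets {K : Set (Pt d)} (hK : IsCompact K) :
    ∃ c₀ : ℝ, 0 ≤ c₀ ∧ ∀ n : ℕ, 0 < n → ∃ Y : Finset (Pt d), Y.card ≤ n ^ (2 * d) ∧
      ∀ x ∈ K, ∃ y ∈ Y, dist x y ≤ c₀ / n ^ 2 := by
  obtain ⟨ρ', hρ'⟩ := hK.isBounded.subset_closedBall 0
  set ρ := max ρ' 1
  have hρ : 0 < ρ := lt_of_lt_of_le one_pos (le_max_right _ _)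
  refine ⟨√d * (2 * ρ), by positivity, fun n hn => ?_⟩
  have hm : 0 < n ^ 2 := by positivity
  classical
  refine ⟨Finset.univ.image fun J : Fin d → Fin (n ^ 2) =>
    (WithLp.toLp 2 fun i => -ρ + 2 * ρ * (J i : ℕ) / ((n ^ 2 : ℕ) : ℝ) : Pt d), ?_, ?_⟩
  · refine Finset.card_image_le.trans (le_of_eq ?_)
    rw [Finset.card_univ, Fintype.card_fun, Fintype.card_fin, Fintype.card_fin, ← pow_mul]
  · intro x hx
    have hxi : ∀ i, |x i| ≤ ρ := by
      intro i
      have h1 := hρ' hx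
      rw [mem_closedBall_zero_iff] at h1
      exact ((Real.norm_eq_abs _).symm.le.trans (PiLp.norm_apply_le x i)).trans
        (h1.trans (le_max_left _ _))
    choose J hJ using fun i => exists_grid_near hρ hm (hxi i)
    refine ⟨_, Finset.mem_image_of_mem _ (Finset.mem_univ J), ?_⟩
    rw [EuclideanSpace.dist_eq]
    have h2 : ∑ i, dist (x i) (-ρ + 2 * ρ * (J i : ℕ) / ((n ^ 2 : ℕ) : ℝ)) ^ 2 ≤
        d * (2 * ρ / n ^ 2) ^ 2 := by
      calc _ ≤ ∑ _i : Fin d, (2 * ρ / (n : ℝ) ^ 2) ^ 2 := by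
            refine Finset.sum_le_sum fun i _ => pow_le_pow_left₀ dist_nonneg ?_ 2
            have := hJ i
            rw [Real.dist_eq]
            push_cast at this ⊢
            exact this
        _ = d * (2 * ρ / n ^ 2) ^ 2 := by simp
    refine (Real.sqrt_le_sqrt h2).trans (le_of_eq ?_)
    rw [Real.sqrt_mul (Nat.cast_nonneg d), Real.sqrt_sq (by positivity)]
    ring

/-! ### Resolution for Hölder densities -/

theorem eventually_mesh_le (hd : 0 < d) (c : ℝ) {A : ℝ} (hA : 0 < A) :
    ∀ᶠ n : ℕ in atTop, ∀ k : ℕ, 1 ≤ k → c / n ^ 2 ≤ (A * k / n) ^ (d : ℝ)⁻¹ := by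
  have hB : 0 < A ^ (d : ℝ)⁻¹ := by positivity
  filter_upwards [eventually_ge_atTop 1,
    tendsto_natCast_atTop_atTop.eventually_ge_atTop (c / A ^ (d : ℝ)⁻¹)] with n hn hc k hk
  have hn1 : (1 : ℝ) ≤ n := by exact_mod_cast hn
  have hk1 : (1 : ℝ) ≤ k := by exact_mod_cast hk
  have hn0 : (0 : ℝ) < n := by linarith
  have hd1 : (1 : ℝ) ≤ d := by exact_mod_cast hd
  calc c / n ^ 2 ≤ A ^ (d : ℝ)⁻¹ / n := by
        rw [div_le_iff₀ hB] at hc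
        rw [div_le_div_iff₀ (by positivity) hn0]
        nlinarith
    _ ≤ A ^ (d : ℝ)⁻¹ / (n : ℝ) ^ (d : ℝ)⁻¹ := by
        gcongr
        calc (n : ℝ) ^ (d : ℝ)⁻¹ ≤ (n : ℝ) ^ (1 : ℝ) :=
              Real.rpow_le_rpow_of_exponent_le hn1 (inv_le_one_of_one_le₀ hd1)
          _ = n := Real.rpow_one _
    _ = (A / n) ^ (d : ℝ)⁻¹ := (Real.div_rpow hA.le hn0.le _).symm
    _ ≤ (A * k / n) ^ (d : ℝ)⁻¹ := by
        gcongr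
        exact le_mul_of_one_le_right hA.le hk1

theorem tendsto_Cdn (hd : 0 < d) {δ : ℝ} (hδ₀ : 0 < δ) (hδ₁ : δ < 1) :
    Tendsto (fun n : ℕ => Cdn d δ n) atTop atTop := by
  have hL : 0 < 16 * Real.log (2 / δ) := by
    have := Real.log_pos (show 1 < 2 / δ by rw [lt_div_iff₀ hδ₀]; linarith)
    positivity
  have hd' : (0 : ℝ) < d := Nat.cast_pos.2 hd
  refine Tendsto.const_mul_atTop hL ?_
  exact Real.tendsto_sqrt_atTop.comp
    ((Real.tendsto_log_atTop.comp tendsto_natCast_atTop_atTop).const_mul_atTop hd')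

/-- For a Hölder continuous density, every level is eventually resolved. The number of neighbours
is such that the bias `(k / n) ^ (α / d)` stays below the order `1 / √k`, while the tolerance is of
order `√(log n) / √k`. -/
theorem eventually_resolution (hd : 0 < d) {f : Pt d → ℝ} (hf : ModalDensity f) {δ : ℝ}
    (hδ₀ : 0 < δ) (hδ₁ : δ < 1) {S : ℝ} (hS : 0 < S) (c₀ : ℝ) {α c : ℝ} (hα : 0 < α) (hc : 0 < c)
    (hol : ∀ x y, |f x - f y| ≤ c * ‖x - y‖ ^ α) {C₁ C₂ : ℝ} (hC₁ : 0 < C₁) (hC₂ : 0 < C₂)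
    {k : ℕ → ℕ} (hk : ∀ᶠ n : ℕ in atTop, C₁ * Real.log n ≤ k n ∧
      (k n : ℝ) ≤ C₂ * (n : ℝ) ^ (2 * α / (2 * α + d))) {lam : ℝ} (hlam : 0 < lam) :
    ∀ᶠ n : ℕ in atTop, ∃ η R, Resolution f S (Cdn d δ n / √(k n : ℝ)) (c₀ / n ^ 2) n (k n)
      lam η R := by
  have hv := unitVol_pos d
  have hd' : (0 : ℝ) < d := Nat.cast_pos.2 hd
  obtain ⟨η₀, hη₀, hconn⟩ := exists_uniform_connection hf (half_pos hlam)
  set η := min η₀ lam with hηdef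
  have hη : 0 < η := lt_min hη₀ hlam
  set B : ℝ := 17 / (unitVol d * η) with hB
  have hB0 : 0 < B := by positivity
  set G : ℝ := (16 / 9 : ℝ) ^ (d : ℝ)⁻¹ - 1 with hG
  have hG0 : 0 < G := sub_pos.2 (Real.one_lt_rpow (by norm_num) (by positivity))
  set e : ℝ := α / d + 1 / 2 with he
  set W : ℝ := 64 * c * B ^ (α / d) / η * C₂ ^ e with hW
  filter_upwards [hk, eventually_ge_atTop 2, eventually_mesh_le hd c₀ hB0,
    eventually_mesh_le hd (2 * c₀ / G) (show 0 < 1 / (4 * unitVol d * S) by positivity),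
    (tendsto_Cdn hd hδ₀ hδ₁).eventually_ge_atTop W] with n hkn hn hm1 hm2 hCn
  have hn2 : (2 : ℝ) ≤ n := by exact_mod_cast hn
  have hn0 : (0 : ℝ) < n := by linarith
  have hk0 : (0 : ℝ) < k n :=
    lt_of_lt_of_le (mul_pos hC₁ (Real.log_pos (by linarith))) hkn.1
  have hk1 : 1 ≤ k n := Nat.cast_pos.1 hk0
  set R : ℝ := (B * k n / n) ^ (d : ℝ)⁻¹ with hR
  have hR0 : 0 < R := by positivity
  have hRd : R ^ d = B * k n / n := Real.rpow_inv_natCast_pow (by positivity) hd.ne'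
  refine ⟨η, R, hη, min_le_right _ _, hR0, ?_, ?_, ?_, hm1 _ hk1, ?_⟩
  · intro x y hxy
    rw [dist_eq_norm] at hxy
    have h1 : c * ‖x - y‖ ^ α ≤ c * R ^ α := by gcongr
    have h2 : R ^ α = B ^ (α / d) * ((k n : ℝ) ^ (α / d) / (n : ℝ) ^ (α / d)) := by
      rw [hR, ← Real.rpow_mul (by positivity), show (d : ℝ)⁻¹ * α = α / d by ring, mul_div_assoc,
        Real.mul_rpow hB0.le (by positivity), Real.div_rpow hk0.le hn0.le]
    have h3 : (k n : ℝ) ^ (α / d) * √(k n : ℝ) ≤ C₂ ^ e * (n : ℝ) ^ (α / d) := by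
      calc (k n : ℝ) ^ (α / d) * √(k n : ℝ) = (k n : ℝ) ^ e := by
            rw [Real.sqrt_eq_rpow, ← Real.rpow_add hk0]
        _ ≤ (C₂ * (n : ℝ) ^ (2 * α / (2 * α + d))) ^ e := by
            have : 0 ≤ e := by positivity
            exact Real.rpow_le_rpow hk0.le hkn.2 this
        _ = C₂ ^ e * (n : ℝ) ^ (α / d) := by
            rw [Real.mul_rpow hC₂.le (by positivity), ← Real.rpow_mul hn0.le]
            congr 2
            rw [he]; field_simp
    have hs0 : 0 < √(k n : ℝ) := Real.sqrt_pos.2 hk0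
    have hn1 : 0 < (n : ℝ) ^ (α / d) := by positivity
    have h4 : c * R ^ α ≤ W * η / 64 / √(k n : ℝ) := by
      rw [h2, le_div_iff₀ hs0, hW]
      have h5 : (k n : ℝ) ^ (α / d) * √(k n : ℝ) / (n : ℝ) ^ (α / d) ≤ C₂ ^ e := by
        rwa [div_le_iff₀ hn1]
      calc c * (B ^ (α / d) * ((k n : ℝ) ^ (α / d) / (n : ℝ) ^ (α / d))) * √(k n : ℝ)
          = c * B ^ (α / d) * ((k n : ℝ) ^ (α / d) * √(k n : ℝ) / (n : ℝ) ^ (α / d)) := by ring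
        _ ≤ c * B ^ (α / d) * C₂ ^ e := by gcongr
        _ = 64 * c * B ^ (α / d) / η * C₂ ^ e * η / 64 := by field_simp
    refine (hol x y).trans (h1.trans (h4.trans ?_))
    rw [show Cdn d δ n / √(k n : ℝ) * η / 64 = Cdn d δ n * η / 64 / √(k n : ℝ) by ring]
    gcongr
  · have : n * unitVol d * R ^ d * η = 17 * k n := by
      rw [hRd, hB]; field_simp
    rw [this]
    linarith
  · intro x y hx hy hxy
    exact connectedComponentIn_mono _ (levelSet_anti (min_le_left _ _)) (hconn x y hx hy hxy)
  · have h1 := hm2 _ hk1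
    have h2 : (1 / (4 * unitVol d * S) * k n / n : ℝ) = k n / (4 * n * unitVol d * S) := by
      field_simp
    rw [h2] at h1
    have h3 := mul_le_mul_of_nonneg_left h1 hG0.le
    refine le_trans (le_of_eq ?_) h3
    field_simp

/-! ### The pruning guarantee -/

/-- If `k` is too small to be admissible for any set, the pruning guarantee is void: as soon as there
is an estimate above the level in question, some `ε₀`-modal set is a target. -/
theorem pruningHolds_of_not_admissible {f : Pt d → ℝ} (hf : ModalDensity f) {δ ε₀ εt : ℝ}
    (hε₀ : EpsDensity f ε₀) (hδ₀ : 0 < δ) (hδ₁ : δ < 1) {n k : ℕ} {lam : ℝ} (hlam : 0 ≤ lam)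
    (h : ∀ rs M, ¬ Admissible f δ ε₀ εt rs n k M) (X : Fin n → Pt d) :
    PruningHolds f δ ε₀ εt k lam X := by
  intro σ _ t ht ⟨rs, _, hadm⟩
  have hno : ∀ e ∈ estimates δ ε₀ εt X k σ, ¬ t ≤ e.1 := by
    intro e he hte
    obtain ⟨i, hi, -⟩ := exists_mem_of_mem_estimates he
    obtain ⟨M, hM, hmax⟩ := exists_isEpsModalSet_max hf hε₀
    refine h rs M (hadm M ⟨hM, i, ?_, hmax _⟩)
    have hβ : 0 ≤ beta d δ n k := by
      have := Cdn_nonneg d hδ₀ hδ₁ n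
      unfold beta
      positivity
    have : 0 ≤ beta d δ n k * t := mul_nonneg hβ (hlam.trans ht)
    rw [hi]
    linarith
  exact ⟨fun _ => ∅, fun e he => absurd he.2 (hno e he.1), fun e he hte => absurd hte (hno e he)⟩

end MCores

end

theorem theorem2 (d : ℕ) (hd : 0 < d) (f : MCores.Pt d → ℝ) (hf : MCores.ModalDensity f)
    (δ : ℝ) (hδ₀ : 0 < δ) (hδ₁ : δ < 1)
    (ε₀ : ℝ) (hε₀ : MCores.EpsDensity f ε₀) (εt : ℝ) (hεt : 0 ≤ εt) :
    ∃ lam₀ : ℕ → ℕ → ℝ,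
      (∀ n k : ℕ, 1 ≤ k → k ≤ n →
        Measure.pi (fun _ : Fin n => MCores.law f)
          {X | ¬ MCores.PruningHolds f δ ε₀ εt k (lam₀ n k) X} ≤ ENNReal.ofReal δ) ∧
      (εt = 0 → ∀ α c : ℝ, 0 < α → α ≤ 1 → 0 < c →
        (∀ x y, |f x - f y| ≤ c * ‖x - y‖ ^ α) →
        ∀ C₁ C₂ : ℝ, 0 < C₁ → 0 < C₂ → ∀ k : ℕ → ℕ,
          (∀ᶠ n : ℕ in atTop, C₁ * Real.log n ≤ k n ∧
            (k n : ℝ) ≤ C₂ * (n : ℝ) ^ (2 * α / (2 * α + d))) →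
          Tendsto (fun n => lam₀ n (k n)) atTop (𝓝 0)) := by
  obtain ⟨S, hS, hfS⟩ := hf.exists_bound
  obtain ⟨c₀, -, hnets⟩ := MCores.exists_nets hf.compact_support.isCompact
  -- the resolved levels, and those above all density estimates of typical samples
  set Λ : ℕ → ℕ → Set ℝ := fun n k => {lam | 0 < lam ∧ ((∃ η R, MCores.Resolution f S
    (MCores.Cdn d δ n / √(k : ℝ)) (c₀ / n ^ 2) n k lam η R) ∨ 2 * S ≤ lam)} with hΛ
  have hex : ∀ n k, ∃ lam ∈ Λ n k, ∀ lam' ∈ Λ n k, lam ≤ lam' + 1 / ((n : ℝ) + 1) := by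
    intro n k
    obtain ⟨lam, hlam, hlt⟩ := Real.lt_sInf_add_pos (s := Λ n k)
      ⟨2 * S, by positivity, Or.inr le_rfl⟩ (ε := 1 / ((n : ℝ) + 1)) (by positivity)
    exact ⟨lam, hlam, fun lam' hlam' => hlt.le.trans
      (add_le_add_left (csInf_le ⟨0, fun a ha => ha.1.le⟩ hlam') _)⟩
  choose lam₀ hlam₀ hmin using hex
  refine ⟨lam₀, ?_, ?_⟩
  · intro n k hk hkn
    by_cases hgood : 0 < MCores.Cdn d δ n ∧ (2 : ℝ) ^ (7 + d) * MCores.Cdn d δ n ^ 2 ≤ k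
    swap
    · have : {X | ¬ MCores.PruningHolds f δ ε₀ εt k (lam₀ n k) X} = (∅ : Set (Fin n → _)) :=
        Set.eq_empty_of_forall_notMem fun X hX => hX
          (MCores.pruningHolds_of_not_admissible hf hε₀ hδ₀ hδ₁ (hlam₀ n k).1.le
            (fun rs M h => hgood (h.pos_and_le hd hδ₀ hδ₁ hk)) X)
      rw [this]
      simp
    obtain ⟨hC, hkC⟩ := hgood
    have hn : 0 < n := lt_of_lt_of_le hk hkn
    obtain ⟨Y, hYcard, hY⟩ := hnets n hn
    set κ := MCores.Cdn d δ n / √(k : ℝ) with hκdef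
    obtain ⟨hκ, hκ', hD, hε1, hε2, hfail⟩ := MCores.failure_bound hd hδ₀ hδ₁ hC hkC hn hκdef
    have := MCores.isProbabilityMeasure_law hf
    have hk0 : (0 : ℝ) < k := Nat.cast_pos.2 hk
    have hDk : 2 * (κ * k) ≤ k := by nlinarith
    refine le_trans (measure_mono ?_) ((MCores.measure_not_typicalSample_le
      (MCores.hasRadii_law hf hd) hkn hD hDk Y (MCores.hitRadius f n k) hε1 hε2).trans
      (ENNReal.ofReal_le_ofReal (le_trans ?_ hfail)))
    · intro X hX hT
      refine hX fun σ hσ t ht _ => ?_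
      rcases (hlam₀ n k).2 with ⟨η, R, hR⟩ | h2S
      · exact MCores.exists_injOn_of_resolution hf hε₀ hd hk hκ' hκ hfS hT hR hY rfl hεt hσ ht
      · have hno : ∀ e ∈ MCores.estimates δ ε₀ εt X k σ, ¬ t ≤ e.1 := by
          intro e he hte
          obtain ⟨i, hi, -⟩ := MCores.exists_mem_of_mem_estimates he
          have := MCores.fk_lt_of_typical hf hd hk hκ' hT hS hfS i
          linarith
        exact ⟨fun _ => ∅, fun e he => absurd he.2 (hno e he.1),
          fun e he hte => absurd hte (hno e he)⟩
    · have : (Y.card : ℝ) ≤ (n : ℝ) ^ (2 * d) := by exact_mod_cast hYcard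
      gcongr
  · intro _ α c hα _ hc hol C₁ C₂ hC₁ hC₂ k hk
    refine tendsto_order.2 ⟨fun a ha => Eventually.of_forall fun n => ha.trans (hlam₀ n (k n)).1,
      fun a ha => ?_⟩
    have h1 : ∀ᶠ n : ℕ in atTop, 1 / ((n : ℝ) + 1) < a / 2 :=
      tendsto_one_div_add_atTop_nhds_zero_nat.eventually (gt_mem_nhds (half_pos ha))
    filter_upwards [h1, MCores.eventually_resolution hd hf hδ₀ hδ₁ hS c₀ hα hc hol hC₁ hC₂ hk
      (half_pos ha)] with n hn hres
    have := hmin n (k n) (a / 2) ⟨half_pos ha, Or.inl hres⟩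
    linarith
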